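/- Let $n\ge 3$ and let $P$ be a convex polygon with vertices $1,\dots,n$, numbered clockwise. A diagonal of $P$ is a segment joining two vertices that are not the ends of a side. A tiling $T$ of $P$ is a set of pairwise non-crossing diagonals. The tiles of $T$ are the polygons into which these diagonals subdivide $P$; the size of a tile is its number of vertices. The strand diagram of $T$ consists of the following oriented strand segments. In each tile, with vertices $q_1,\dots,q_r$ in clockwise order (indices modulo $r$), there is for each $i$ one segment that enters the tile through the side $[q_i,q_{i+1}]$ near $q_i$, runs parallel to $[q_{i-1},q_i]$, and leaves the tile through the side $[q_{i-2},q_{i-1}]$ near $q_{i-1}$. Whenever a segment leaves a tile through a diagonal near one of its ends, it is continued by the segment of the adjacent tile that enters through this diagonal near the same end. The resulting maximal paths are the strands of $T$. Exactly one strand starts at each vertex $x$, namely the one entering $P$ near $x$ through the side $[x,x+1]$, and exactly one ends at each vertex $y$, namely the one leaving $P$ near $y$ through the side $[y-1,y]$ (vertices modulo $n$). The Scott permutation $\Sigma(T)$ of $\{1,\dots,n\}$ sends $x$ to $y$ if the strand starting at $x$ ends at $y$. A flip replaces a diagonal of $T$ that is the common side of two triangular tiles by the other diagonal of the quadrilateral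 formed by these two triangles. Two tilings are flip equivalent if they are related by a finite sequence of flips. **Theorem.** Let $T_1,T_2$ be tilings of an $n$-gon. Then $\Sigma(T_1)=\Sigma(T_2)$ if and only if $T_1$ and $T_2$ are flip equivalent; that is, the fibres of the Scott map $\Sigma$ are the flip equivalence classes. Moreover, $T_1$ and $T_2$ are flip equivalent if and only if they have the same tiles of size at least $4$. -/

import Mathlib

/-! Tilings of a convex polygon, their strand diagrams, Scott permutations and flips.

The vertices of the `n`-gon are the elements of `Fin n`, numbered consecutively in clockwise
order; `sbtw a b c` is Mathlib's strict cyclic order: going clockwise from `a`, one meets `b`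
strictly before `c`, and `a`, `b`, `c` are distinct. -/

namespace PolygonTiling

/-- `b` is the vertex that follows `a` immediately, in clockwise order, among the vertices in `S`.
For `S` the set of all vertices, this says that `a`, `b` are the ends of a side of the polygon,
with `b` the clockwise neighbour of `a`. -/
def Follows {n : ℕ} (S : Finset (Fin n)) (a b : Fin n) : Prop :=
  a ∈ S ∧ b ∈ S ∧ a ≠ b ∧ ∀ k ∈ S, ¬ sbtw a k b

/-- A tiling of the `n`-gon: a set of pairwise non-crossing diagonals. A diagonal is an unordered
pair of distinct vertices that are not the ends of a side; two diagonals cross if the ends of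
either are strictly separated by the other. -/
structure Tiling (n : ℕ) where
  diagonals : Finset (Sym2 (Fin n))
  isDiagonal : ∀ a b, s(a, b) ∈ diagonals →
    a ≠ b ∧ ¬ Follows Finset.univ a b ∧ ¬ Follows Finset.univ b a
  noncrossing : ∀ a b c d, s(a, b) ∈ diagonals → s(c, d) ∈ diagonals →
    ¬ (sbtw a c b ∧ sbtw b d a)

/-- The edges of a tiling: its diagonals and the sides of the polygon. -/
def Tiling.IsEdge {n : ℕ} (T : Tiling n) (a b : Fin n) : Prop :=
  s(a, b) ∈ T.diagonals ∨ Follows Finset.univ a b ∨ Follows Finset.univ b a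

/-- `Q` is the vertex set of a tile of `T`, that is, of one of the polygons into which the diagonals
of `T` subdivide the `n`-gon: the convex hull of `Q` is a polygon, all of whose sides are edges of
`T`, and no diagonal of `T` runs through its interior. The size of the tile is `Q.card`. -/
def Tiling.IsTile {n : ℕ} (T : Tiling n) (Q : Finset (Fin n)) : Prop :=
  3 ≤ Q.card ∧ (∀ a b, Follows Q a b → T.IsEdge a b) ∧
    ∀ a ∈ Q, ∀ b ∈ Q, s(a, b) ∈ T.diagonals → Follows Q a b ∨ Follows Q b a

/-- The strand segments in the tiles of `T`. Each tile carries one segment for each of its sides.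
If `d`, `c`, `a`, `b` are consecutive vertices of the tile in clockwise order (`d = b` in a
triangle), then the segment belonging to the side `[c, a]` enters the tile through the side `[a, b]`
near `a`, runs parallel to `[c, a]`, and leaves the tile through the side `[d, c]` near `c`.

The pair `(a, b)` stands for crossing the edge `[a, b]` near `a`, moving into the side of the edge
on which `b` follows `a` clockwise. Leaving a tile through `[d, c]` near `c`, the strand enters the
next tile, in which `d` follows `c` clockwise; this is the pair `(c, d)`. -/
def Tiling.Segment {n : ℕ} (T : Tiling n) (e f : Fin n × Fin n) : Prop :=
  ∃ Q, T.IsTile Q ∧ Follows Q e.1 e.2 ∧ Follows Q f.1 e.1 ∧ Follows Q f.2 f.1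

/-- `T.Strand x y`: the strand starting at the vertex `x` ends at the vertex `y`. It enters the
polygon near `x` through the side from `x` to its clockwise neighbour, follows a sequence of
consecutive segments, and leaves the polygon near `y` through the side from `y` to its
anticlockwise neighbour. -/
def Tiling.Strand {n : ℕ} (T : Tiling n) (x y : Fin n) : Prop :=
  ∃ x' y', Follows Finset.univ x x' ∧ Follows Finset.univ y' y ∧
    Relation.ReflTransGen T.Segment (x, x') (y, y')

/-! ### Every strand starts and ends at exactly one vertex -/

theorem sbtw_iff_val {n : ℕ} {a b c : Fin n} : sbtw a b c ↔
    (a.1 < b.1 ∧ b.1 < c.1) ∨ (b.1 < c.1 ∧ c.1 < a.1) ∨ (c.1 < a.1 ∧ a.1 < b.1) := Iff.rfl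

/-- Number of clockwise steps from `a` to `b`. -/
def cw {n : ℕ} (a b : Fin n) : ℕ := if a.1 ≤ b.1 then b.1 - a.1 else b.1 + n - a.1

theorem cw_self {n : ℕ} (a : Fin n) : cw a a = 0 := by simp [cw]

theorem cw_inj {n : ℕ} {o a b : Fin n} : cw o a = cw o b ↔ a = b := by
  have := o.2; have := a.2; have := b.2
  rw [Fin.ext_iff]; unfold cw; split_ifs <;> omega

theorem sbtw_iff_cw {n : ℕ} (o : Fin n) {a b c : Fin n} : sbtw a b c ↔
    (cw o a < cw o b ∧ cw o b < cw o c) ∨ (cw o b < cw o c ∧ cw o c < cw o a) ∨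
      (cw o c < cw o a ∧ cw o a < cw o b) := by
  have := o.2; have := a.2; have := b.2; have := c.2
  rw [sbtw_iff_val]; unfold cw; split_ifs <;> omega

theorem exists_next {n : ℕ} (S : Finset (Fin n)) (v p : Fin n) (hp : p ∈ S) (hpv : p ≠ v) :
    ∃ w ∈ S, w ≠ v ∧ ∀ k ∈ S, ¬ sbtw v k w := by
  obtain ⟨w, hw, hmin⟩ := Finset.exists_min_image (S.erase v) (cw v)
    ⟨p, Finset.mem_erase.2 ⟨hpv, hp⟩⟩
  rw [Finset.mem_erase] at hw
  refine ⟨w, hw.2, hw.1, fun k hk hs => ?_⟩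
  rw [sbtw_iff_cw v, cw_self] at hs
  have hkv : k ≠ v := by
    rintro rfl
    rw [cw_self] at hs; omega
  have := hmin k (Finset.mem_erase.2 ⟨hkv, hk⟩)
  omega

theorem exists_prev {n : ℕ} (S : Finset (Fin n)) (v p : Fin n) (hp : p ∈ S) (hpv : p ≠ v) :
    ∃ w ∈ S, w ≠ v ∧ ∀ k ∈ S, ¬ sbtw w k v := by
  obtain ⟨w, hw, hmax⟩ := Finset.exists_max_image (S.erase v) (cw v)
    ⟨p, Finset.mem_erase.2 ⟨hpv, hp⟩⟩
  rw [Finset.mem_erase] at hw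
  refine ⟨w, hw.2, hw.1, fun k hk hs => ?_⟩
  rw [sbtw_iff_cw v, cw_self] at hs
  have hkv : k ≠ v := by
    rintro rfl
    rw [cw_self] at hs; omega
  have := hmax k (Finset.mem_erase.2 ⟨hkv, hk⟩)
  omega

theorem exists_other {n : ℕ} {S : Finset (Fin n)} (h : 2 ≤ S.card) (v : Fin n) :
    ∃ p ∈ S, p ≠ v := by
  obtain ⟨a, ha, b, hb, hab⟩ := Finset.one_lt_card.1 h
  by_cases hav : a = v
  · exact ⟨b, hb, fun h => hab (hav.trans h.symm)⟩
  · exact ⟨a, ha, hav⟩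

theorem exists_follows {n : ℕ} {S : Finset (Fin n)} (h : 2 ≤ S.card) {a : Fin n} (ha : a ∈ S) :
    ∃ b, Follows S a b := by
  obtain ⟨p, hp, hpa⟩ := exists_other h a
  obtain ⟨w, hw, hwa, hk⟩ := exists_next S a p hp hpa
  exact ⟨w, ha, hw, hwa.symm, hk⟩

theorem exists_precedes {n : ℕ} {S : Finset (Fin n)} (h : 2 ≤ S.card) {a : Fin n} (ha : a ∈ S) :
    ∃ b, Follows S b a := by
  obtain ⟨p, hp, hpa⟩ := exists_other h a
  obtain ⟨w, hw, hwa, hk⟩ := exists_prev S a p hp hpa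
  exact ⟨w, hw, ha, hwa, hk⟩

theorem exists_gap {n : ℕ} {S : Finset (Fin n)} (h : 2 ≤ S.card) {v : Fin n} (hv : v ∉ S) :
    ∃ p q, Follows S p q ∧ sbtw p v q := by
  obtain ⟨x, hx, hxv⟩ := exists_other h v
  obtain ⟨q, hq, hqv, hqk⟩ := exists_next S v x hx hxv
  obtain ⟨p, hp, hpv, hpk⟩ := exists_prev S v x hx hxv
  have hpq : p ≠ q := by
    rintro rfl
    obtain ⟨y, hy, hyp⟩ := exists_other h p
    have h1 := hqk y hy
    have h2 := hpk y hy
    have hyv : y ≠ v := fun h => hv (h ▸ hy)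
    rw [sbtw_iff_cw v, cw_self] at h1 h2
    have h3 := mt (cw_inj (o := v)).1 hyp
    have h4 := mt (cw_inj (o := v)).1 hyv
    have h5 := mt (cw_inj (o := v)).1 hpv
    rw [cw_self] at h4 h5
    omega
  have h1 := hqk p hp
  have h3 := mt (cw_inj (o := v)).1 hpq
  have h4 := mt (cw_inj (o := v)).1 hpv
  have h5 := mt (cw_inj (o := v)).1 hqv
  rw [sbtw_iff_cw v, cw_self] at h1
  rw [cw_self] at h4 h5
  refine ⟨p, q, ⟨hp, hq, hpq, fun k hk hs => ?_⟩, ?_⟩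
  · have h6 := hqk k hk
    have h7 := hpk k hk
    have h8 := mt (cw_inj (o := v)).1 (show k ≠ v from fun h => hv (h ▸ hk))
    rw [sbtw_iff_cw v, cw_self] at h6 h7
    rw [sbtw_iff_cw v] at hs
    rw [cw_self] at h8
    omega
  · rw [sbtw_iff_cw v, cw_self]
    omega

theorem Follows.right_unique {n : ℕ} {S : Finset (Fin n)} {a b c : Fin n}
    (h : Follows S a b) (h' : Follows S a c) : b = c := by
  obtain ⟨-, hb, hab, h1⟩ := h
  obtain ⟨-, hc, hac, h2⟩ := h'
  have h1 := h1 c hc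
  have h2 := h2 b hb
  rw [sbtw_iff_cw a, cw_self] at h1 h2
  have h3 := mt (cw_inj (o := a)).1 hab.symm
  have h4 := mt (cw_inj (o := a)).1 hac.symm
  rw [cw_self] at h3 h4
  rw [← cw_inj (o := a)]
  omega

theorem Follows.left_unique {n : ℕ} {S : Finset (Fin n)} {a b c : Fin n}
    (h : Follows S b a) (h' : Follows S c a) : b = c := by
  obtain ⟨hb, -, hab, h1⟩ := h
  obtain ⟨hc, -, hac, h2⟩ := h'
  have h1 := h1 c hc
  have h2 := h2 b hb
  rw [sbtw_iff_cw a, cw_self] at h1 h2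
  have h3 := mt (cw_inj (o := a)).1 hab
  have h4 := mt (cw_inj (o := a)).1 hac
  rw [cw_self] at h3 h4
  rw [← cw_inj (o := a)]
  omega

theorem Follows.not_both {n : ℕ} {S : Finset (Fin n)} (hS : 3 ≤ S.card) {a b : Fin n}
    (h : Follows S a b) (h' : Follows S b a) : False := by
  have hsub : S ⊆ {a, b} := by
    intro k hk
    have h1 := h.2.2.2 k hk
    have h2 := h'.2.2.2 k hk
    rw [sbtw_iff_cw a, cw_self] at h1 h2
    by_contra hne
    simp only [Finset.mem_insert, Finset.mem_singleton, not_or] at hne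
    have h3 := mt (cw_inj (o := a)).1 hne.1
    have h4 := mt (cw_inj (o := a)).1 hne.2
    have h5 := mt (cw_inj (o := a)).1 h.2.2.1
    rw [cw_self] at h3 h5
    omega
  have h1 := Finset.card_le_card hsub
  have h2 := Finset.card_le_two (a := a) (b := b)
  omega

theorem Tiling.IsEdge.symm {n : ℕ} {T : Tiling n} {a b : Fin n} (h : T.IsEdge a b) :
    T.IsEdge b a := by
  rcases h with h | h | h
  · exact Or.inl (Sym2.eq_swap ▸ h)
  · exact Or.inr (Or.inr h)
  · exact Or.inr (Or.inl h)

/-- Two edges of a tiling do not cross. -/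
theorem Tiling.IsEdge.not_cross {n : ℕ} {T : Tiling n} {a b c d : Fin n} (h : T.IsEdge a b)
    (h' : T.IsEdge c d) (h1 : sbtw a c b) (h2 : sbtw b d a) : False := by
  rcases h with h | h | h
  · rcases h' with h' | h' | h'
    · exact T.noncrossing a b c d h h' ⟨h1, h2⟩
    · have := h'.2.2.2 b (Finset.mem_univ _)
      rw [sbtw_iff_cw a, cw_self] at *
      omega
    · have := h'.2.2.2 a (Finset.mem_univ _)
      rw [sbtw_iff_cw a, cw_self] at *
      omega
  · exact h.2.2.2 c (Finset.mem_univ _) h1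
  · exact h.2.2.2 d (Finset.mem_univ _) h2

theorem Tiling.IsEdge.diag {n : ℕ} {T : Tiling n} {a b c d : Fin n} (h : T.IsEdge a b)
    (h1 : sbtw a c b) (h2 : sbtw b d a) : s(a, b) ∈ T.diagonals := by
  rcases h with h | h | h
  · exact h
  · exact absurd h1 (h.2.2.2 c (Finset.mem_univ _))
  · exact absurd h2 (h.2.2.2 d (Finset.mem_univ _))

/-- A tile is contained in any other tile with which it shares a directed side. -/
theorem Tiling.IsTile.subset {n : ℕ} {T : Tiling n} {Q Q' : Finset (Fin n)} (hQ : T.IsTile Q)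
    (hQ' : T.IsTile Q') {a b : Fin n} (h : Follows Q a b) (h' : Follows Q' a b) : Q ⊆ Q' := by
  intro v hv
  by_contra hv'
  obtain ⟨p, q, hpq, hvpq⟩ := exists_gap (by have := hQ'.1; omega) hv'
  have hne : ¬ (p = b ∧ q = a) := by
    rintro ⟨rfl, rfl⟩
    exact hpq.not_both hQ'.1 h'
  have hav : v ≠ a := fun e => hv' (e ▸ h'.1)
  have hbv : v ≠ b := fun e => hv' (e ▸ h'.2.1)
  have o1 := h.2.2.2 v hv
  have o2 := hpq.2.2.2 a h'.1
  have o3 := hpq.2.2.2 b h'.2.1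
  have o4 := h'.2.2.2 p hpq.1
  have o5 := h'.2.2.2 q hpq.2.1
  have hab := h.2.2.1
  rw [Ne, ← cw_inj (o := b)] at hav hbv hab
  rw [← cw_inj (o := b), ← cw_inj (o := b) (a := q)] at hne
  rw [sbtw_iff_cw b] at o1 o2 o3 o4 o5
  have hvpq' := hvpq
  rw [sbtw_iff_cw b] at hvpq'
  rw [cw_self] at *
  -- linear order of the vertices, starting from `b`
  have l1 : cw b p < cw b v := by omega
  have l2 : cw b v < cw b q := by omega
  have l3 : cw b q ≤ cw b a := by omega
  have l4 : 0 < cw b p ∨ cw b q < cw b a := by omega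
  clear o1 o2 o3 o4 o5 hvpq' hne
  have hE := hQ'.2.1 p q hpq
  have hD : s(p, q) ∈ T.diagonals := by
    rcases l4 with l4 | l4
    · exact hE.diag (d := b) hvpq (by rw [sbtw_iff_cw b, cw_self]; omega)
    · exact hE.diag (d := a) hvpq (by rw [sbtw_iff_cw b]; omega)
  by_cases hp : p ∈ Q
  · by_cases hq : q ∈ Q
    · rcases hQ.2.2 p hp q hq hD with hf | hf
      · exact hf.2.2.2 v hv hvpq
      · have o1 := hf.2.2.2 a h.1
        have o2 := hf.2.2.2 b h.2.1
        rw [sbtw_iff_cw b] at o1 o2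
        rw [cw_self] at o2
        omega
    · obtain ⟨x, y, hxy, hs⟩ := exists_gap (by have := hQ.1; omega) hq
      have hE' := hQ.2.1 x y hxy
      have o1 := hxy.2.2.2 a h.1
      have o3 := hxy.2.2.2 v hv
      have o4 := hxy.2.2.2 p hp
      have hqa := mt (cw_inj (o := b)).1 (show q ≠ a from fun e => hq (e ▸ h.1))
      rw [sbtw_iff_cw b] at o1 o3 o4 hs
      have m1 : cw b x < cw b q ∧ cw b q < cw b y := by
        clear o3
        omega
      have m2 : cw b v ≤ cw b x := by
        clear o1 o4 hs
        omega
      exact hE'.not_cross hE.symm (by rw [sbtw_iff_cw b]; omega) (by rw [sbtw_iff_cw b]; omega)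
  · obtain ⟨x, y, hxy, hs⟩ := exists_gap (by have := hQ.1; omega) hp
    have hE' := hQ.2.1 x y hxy
    have o1 := hxy.2.2.2 a h.1
    have o2 := hxy.2.2.2 b h.2.1
    have o3 := hxy.2.2.2 v hv
    have hpb := mt (cw_inj (o := b)).1 (show p ≠ b from fun e => hp (e ▸ h.2.1))
    have hyb := mt (cw_inj (o := b)).1 hxy.2.2.1
    rw [sbtw_iff_cw b] at o1 o2 o3 hs
    rw [cw_self] at o2 hpb
    have m1 : cw b p < cw b y ∧ cw b y ≤ cw b v := by
      omega
    have m2 : cw b x < cw b p := by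
      clear o1 o3
      omega
    exact hE'.not_cross hE (by rw [sbtw_iff_cw b]; omega) (by rw [sbtw_iff_cw b]; omega)

theorem Tiling.IsTile.unique {n : ℕ} {T : Tiling n} {Q Q' : Finset (Fin n)} (hQ : T.IsTile Q)
    (hQ' : T.IsTile Q') {a b : Fin n} (h : Follows Q a b) (h' : Follows Q' a b) : Q = Q' :=
  Finset.Subset.antisymm (hQ.subset hQ' h h') (hQ'.subset hQ h' h)

/-- `v` is cut off from the edge `[a, b]` by the diagonal `[c, d]`. -/
def Tiling.Cuts {n : ℕ} (T : Tiling n) (a b v c d : Fin n) : Prop :=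
  s(c, d) ∈ T.diagonals ∧ sbtw c v d ∧ ¬ sbtw c a d ∧ ¬ sbtw c b d ∧ ¬ (c = b ∧ d = a)

theorem Tiling.Cuts.linear {n : ℕ} {T : Tiling n} {a b v c d : Fin n} (h : T.Cuts a b v c d)
    (hv : sbtw b v a) : cw b c < cw b v ∧ cw b v < cw b d ∧ cw b d ≤ cw b a ∧
      (0 < cw b c ∨ cw b d < cw b a) := by
  obtain ⟨-, h1, h2, h3, h4⟩ := h
  rw [← cw_inj (o := b), ← cw_inj (o := b) (a := d)] at h4
  rw [sbtw_iff_cw b] at *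
  rw [cw_self] at *
  omega

theorem Tiling.cuts_of_linear {n : ℕ} {T : Tiling n} {a b v c d : Fin n}
    (h : s(c, d) ∈ T.diagonals)
    (h' : cw b c < cw b v ∧ cw b v < cw b d ∧ cw b d ≤ cw b a ∧
      (0 < cw b c ∨ cw b d < cw b a)) : T.Cuts a b v c d := by
  refine ⟨h, ?_, ?_, ?_, ?_⟩
  · rw [sbtw_iff_cw b]; omega
  · rw [sbtw_iff_cw b]; omega
  · rw [sbtw_iff_cw b, cw_self]; omega
  · rintro ⟨rfl, rfl⟩
    rw [cw_self] at h'
    omega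

/-- Every edge of the tiling is a side of a tile on each side of it that lies within the polygon. -/
theorem Tiling.exists_tile {n : ℕ} (T : Tiling n) {a b : Fin n} (hE : T.IsEdge a b) (hab : a ≠ b)
    (hba : ¬ Follows Finset.univ b a) : ∃ Q, T.IsTile Q ∧ Follows Q a b := by
  classical
  let F : Finset (Fin n) := Finset.univ.filter fun v =>
    v = a ∨ v = b ∨ (sbtw b v a ∧ ∀ c d, ¬ T.Cuts a b v c d)
  have memF : ∀ v, v ∈ F ↔ v = a ∨ v = b ∨ (sbtw b v a ∧ ∀ c d, ¬ T.Cuts a b v c d) := by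
    intro v; simp [F]
  have haF : a ∈ F := (memF a).2 (Or.inl rfl)
  have hbF : b ∈ F := (memF b).2 (Or.inr (Or.inl rfl))
  have hpos : 0 < cw b a := by
    have := mt (cw_inj (o := b)).1 hab
    rw [cw_self] at this
    omega
  have hle : ∀ v ∈ F, cw b v ≤ cw b a := by
    intro v hv
    rcases (memF v).1 hv with rfl | rfl | ⟨h, -⟩
    · exact le_rfl
    · rw [cw_self]; omega
    · rw [sbtw_iff_cw b, cw_self] at h; omega
  have hFab : Follows F a b := by
    refine ⟨haF, hbF, hab, fun k hk hs => ?_⟩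
    have := hle k hk
    rw [sbtw_iff_cw b, cw_self] at hs
    omega
  -- a vertex of `F` is not cut off
  have huncut : ∀ v ∈ F, ∀ c d, s(c, d) ∈ T.diagonals → cw b c < cw b v → cw b v < cw b d →
      cw b d ≤ cw b a → (0 < cw b c ∨ cw b d < cw b a) → False := by
    intro v hv c d hcd h1 h2 h3 h4
    rcases (memF v).1 hv with rfl | rfl | ⟨-, h⟩
    · omega
    · rw [cw_self] at h1; omega
    · exact h c d (T.cuts_of_linear hcd ⟨h1, h2, h3, h4⟩)
  have hcut : ∀ v, v ∉ F → cw b v < cw b a → ∃ c d, s(c, d) ∈ T.diagonals ∧ cw b c < cw b v ∧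
      cw b v < cw b d ∧ cw b d ≤ cw b a ∧ (0 < cw b c ∨ cw b d < cw b a) := by
    intro v hv hlt
    have hvb : v ≠ b := fun h => hv (h ▸ hbF)
    have h0 := mt (cw_inj (o := b)).1 hvb
    rw [cw_self] at h0
    have hs : sbtw b v a := by rw [sbtw_iff_cw b, cw_self]; omega
    have : ∃ c d, T.Cuts a b v c d := by
      by_contra hcon
      push Not at hcon
      exact hv ((memF v).2 (Or.inr (Or.inr ⟨hs, hcon⟩)))
    obtain ⟨c, d, hc⟩ := this
    exact ⟨c, d, hc.1, hc.linear hs⟩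
  -- consecutive vertices of `F` on the arc from `b` to `a`
  have key : ∀ u v, u ∈ F → v ∈ F → cw b u < cw b v → (∀ k ∈ F, ¬ sbtw u k v) →
      Follows Finset.univ u v ∨
        (s(u, v) ∈ T.diagonals ∧ (0 < cw b u ∨ cw b v < cw b a)) := by
    intro u v hu hv huv hk
    by_cases hfol : Follows Finset.univ u v
    · exact Or.inl hfol
    right
    have hne : u ≠ v := by rintro rfl; omega
    have hw : ∃ w, sbtw u w v := by
      by_contra hcon
      push Not at hcon
      exact hfol ⟨Finset.mem_univ _, Finset.mem_univ _, hne, fun k _ => hcon k⟩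
    obtain ⟨w, hw⟩ := hw
    have hwF : w ∉ F := fun h => hk w h hw
    have hva := hle v hv
    have hw' := hw
    rw [sbtw_iff_cw b] at hw'
    have hw1 : cw b u < cw b w := by omega
    have hw2 : cw b w < cw b v := by omega
    let C : Finset (Fin n × Fin n) := Finset.univ.filter fun e =>
      s(e.1, e.2) ∈ T.diagonals ∧ cw b e.1 < cw b w ∧ cw b w < cw b e.2 ∧
        cw b e.2 ≤ cw b a ∧ (0 < cw b e.1 ∨ cw b e.2 < cw b a)
    have hC : C.Nonempty := by
      obtain ⟨c, d, h⟩ := hcut w hwF (by omega)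
      exact ⟨(c, d), by simpa [C] using h⟩
    obtain ⟨⟨c, d⟩, hcd, hmax⟩ := Finset.exists_max_image C (fun e => cw b e.2 - cw b e.1) hC
    have hcd' : s(c, d) ∈ T.diagonals ∧ cw b c < cw b w ∧ cw b w < cw b d ∧
        cw b d ≤ cw b a ∧ (0 < cw b c ∨ cw b d < cw b a) := by simpa [C] using hcd
    obtain ⟨hD, c1, c2, c3, c4⟩ := hcd'
    have hmax' : ∀ c' d', s(c', d') ∈ T.diagonals → cw b c' < cw b w → cw b w < cw b d' →
        cw b d' ≤ cw b a → (0 < cw b c' ∨ cw b d' < cw b a) →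
        cw b d' - cw b c' ≤ cw b d - cw b c := by
      intro c' d' h1 h2 h3 h4 h5
      exact hmax (c', d') (by simpa [C] using ⟨h1, h2, h3, h4, h5⟩)
    have hvd : cw b v ≤ cw b d := by
      by_contra hlt
      have hdF : d ∉ F := fun h => hk d h (by rw [sbtw_iff_cw b]; omega)
      obtain ⟨c', d', h1, h2, h3, h4, h5⟩ := hcut d hdF (by omega)
      have hle' : cw b c' ≤ cw b c := by
        by_contra hlt'
        exact T.noncrossing c d c' d' hD h1
          ⟨by rw [sbtw_iff_cw b]; omega, by rw [sbtw_iff_cw b]; omega⟩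
      have := hmax' c' d' h1 (by omega) (by omega) h4 h5
      omega
    have hcu : cw b c ≤ cw b u := by
      by_contra hlt
      have hcF : c ∉ F := fun h => hk c h (by rw [sbtw_iff_cw b]; omega)
      obtain ⟨c', d', h1, h2, h3, h4, h5⟩ := hcut c hcF (by omega)
      have hle' : cw b d ≤ cw b d' := by
        by_contra hlt'
        exact T.noncrossing c' d' c d h1 hD
          ⟨by rw [sbtw_iff_cw b]; omega, by rw [sbtw_iff_cw b]; omega⟩
      have := hmax' c' d' h1 (by omega) (by omega) h4 h5
      omega
    have e1 : cw b c = cw b u := by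
      by_contra hne'
      exact huncut u hu c d hD (by omega) (by omega) c3 c4
    have e2 : cw b d = cw b v := by
      by_contra hne'
      exact huncut v hv c d hD (by omega) (by omega) c3 c4
    rw [← e1, ← e2]
    rw [cw_inj] at e1 e2
    subst e1 e2
    exact ⟨hD, c4⟩
  have hcard : 3 ≤ F.card := by
    by_contra hlt
    have hF2 : F = {a, b} := by
      symm
      apply Finset.eq_of_subset_of_card_le
      · intro x hx
        simp only [Finset.mem_insert, Finset.mem_singleton] at hx
        rcases hx with rfl | rfl
        · exact haF
        · exact hbF
      · rw [Finset.card_pair hab]; omega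
    have hk : ∀ k ∈ F, ¬ sbtw b k a := by
      intro k hk hs
      rw [hF2] at hk
      simp only [Finset.mem_insert, Finset.mem_singleton] at hk
      rw [sbtw_iff_cw b, cw_self] at hs
      rcases hk with rfl | rfl
      · omega
      · rw [cw_self] at hs; omega
    rcases key b a hbF haF (by rw [cw_self]; omega) hk with h | ⟨-, h⟩
    · exact hba h
    · rw [cw_self] at h; omega
  refine ⟨F, ⟨hcard, ?_, ?_⟩, hFab⟩
  · intro u v huv
    have hne := mt (cw_inj (o := b)).1 huv.2.2.1
    by_cases hlt : cw b u < cw b v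
    · rcases key u v huv.1 huv.2.1 hlt huv.2.2.2 with h | h
      · exact Or.inr (Or.inl h)
      · exact Or.inl h.1
    · have h1 := huv.2.2.2 a haF
      have h2 := huv.2.2.2 b hbF
      have h3 := hle u huv.1
      rw [sbtw_iff_cw b] at h1 h2
      rw [cw_self] at h2
      have e1 : cw b u = cw b a := by omega
      have e2 : cw b v = cw b b := by rw [cw_self]; omega
      rw [cw_inj] at e1 e2
      rw [e1, e2]
      exact hE
  · have main : ∀ u v, u ∈ F → v ∈ F → cw b u < cw b v → s(u, v) ∈ T.diagonals →
        Follows F u v ∨ Follows F v u := by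
      intro u v hu hv hlt hD
      by_cases h : 0 < cw b u ∨ cw b v < cw b a
      · left
        refine ⟨hu, hv, by rintro rfl; omega, fun k hk hs => ?_⟩
        rw [sbtw_iff_cw b] at hs
        have h1 := hle k hk
        have h2 := hle v hv
        have h3 := huncut k hk u v hD
        have h4 : k ∈ F := hk
        rcases hs with hs | hs | hs
        · exact h3 hs.1 hs.2 h2 h
        · omega
        · omega
      · right
        have h2 := hle v hv
        have e1 : cw b v = cw b a := by omega
        have e2 : cw b u = cw b b := by rw [cw_self]; omega
        rw [cw_inj] at e1 e2
        rw [e1, e2]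
        exact hFab
    intro u hu v hv hD
    have hne := mt (cw_inj (o := b)).1 (T.isDiagonal u v hD).1
    rcases lt_or_gt_of_ne hne with h | h
    · exact main u v hu hv h hD
    · exact (main v u hv hu h (Sym2.eq_swap ▸ hD)).symm

/-- In a finite set, following a relation in which predecessors are unique from an element without
predecessor, one reaches an element without successor. -/
theorem exists_sink {α : Type*} [Finite α] {r : α → α → Prop}
    (hl : ∀ x y z, r x z → r y z → x = y) (x : α)
    (hx : ∀ y, ¬ r y x) : ∃ y, Relation.ReflTransGen r x y ∧ ∀ z, ¬ r y z := by
  by_contra hcon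
  push Not at hcon
  choose f hf using hcon
  let S := {y // Relation.ReflTransGen r x y}
  let g : S → S := fun y => ⟨f y.1 y.2, y.2.tail (hf y.1 y.2)⟩
  have hg : Function.Injective g := by
    intro y z h
    have h' : f y.1 y.2 = f z.1 z.2 := congrArg Subtype.val h
    have hz := hf z.1 z.2
    rw [← h'] at hz
    exact Subtype.ext (hl _ _ _ (hf y.1 y.2) hz)
  obtain ⟨y, hy⟩ := Finite.surjective_of_injective hg ⟨x, .refl⟩
  have h' : f y.1 y.2 = x := congrArg Subtype.val hy
  have hy' := hf y.1 y.2
  rw [h'] at hy'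
  exact hx y.1 hy'

theorem Tiling.segment_right_unique {n : ℕ} (T : Tiling n) (x y z : Fin n × Fin n)
    (h : T.Segment x y) (h' : T.Segment x z) : y = z := by
  obtain ⟨Q, hQ, h1, h2, h3⟩ := h
  obtain ⟨Q', hQ', h1', h2', h3'⟩ := h'
  obtain rfl := hQ.unique hQ' h1 h1'
  have e := h2.left_unique h2'
  rw [← e] at h3'
  exact Prod.ext e (h3.left_unique h3')

theorem Tiling.segment_left_unique {n : ℕ} (T : Tiling n) (x y z : Fin n × Fin n)
    (h : T.Segment x z) (h' : T.Segment y z) : x = y := by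
  obtain ⟨Q, hQ, h1, h2, h3⟩ := h
  obtain ⟨Q', hQ', h1', h2', h3'⟩ := h'
  obtain rfl := hQ.unique hQ' h3 h3'
  have e := h2.right_unique h2'
  rw [← e] at h1'
  exact Prod.ext e (h1.right_unique h1')

theorem not_follows_both {n : ℕ} (hn : 3 ≤ n) {a b : Fin n} (h : Follows Finset.univ a b)
    (h' : Follows Finset.univ b a) : False :=
  h.not_both (by simpa using hn) h'

theorem Tiling.Segment.isEdge {n : ℕ} {T : Tiling n} {e f : Fin n × Fin n} (h : T.Segment e f) :
    (T.IsEdge e.1 e.2 ∧ e.1 ≠ e.2) ∧ (T.IsEdge f.1 f.2 ∧ f.1 ≠ f.2) := by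
  obtain ⟨Q, hQ, h1, h2, h3⟩ := h
  exact ⟨⟨hQ.2.1 _ _ h1, h1.2.2.1⟩, ⟨(hQ.2.1 _ _ h3).symm, h3.2.2.1.symm⟩⟩

/-- There is no segment into a pair at which a strand starts. -/
theorem Tiling.no_segment_to {n : ℕ} (T : Tiling n) {e f : Fin n × Fin n}
    (hf : Follows Finset.univ f.1 f.2) : ¬ T.Segment e f := by
  rintro ⟨Q, hQ, h1, h2, h3⟩
  exact h3.not_both hQ.1 ⟨h3.2.1, h3.1, hf.2.2.1, fun k _ => hf.2.2.2 k (Finset.mem_univ _)⟩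

/-- There is no segment out of a pair at which a strand ends. -/
theorem Tiling.no_segment_from {n : ℕ} (T : Tiling n) {e f : Fin n × Fin n}
    (he : Follows Finset.univ e.2 e.1) : ¬ T.Segment e f := by
  rintro ⟨Q, hQ, h1, h2, h3⟩
  exact h1.not_both hQ.1 ⟨h1.2.1, h1.1, he.2.2.1, fun k _ => he.2.2.2 k (Finset.mem_univ _)⟩

theorem Tiling.exists_segment_from {n : ℕ} (T : Tiling n) {e : Fin n × Fin n}
    (he : T.IsEdge e.1 e.2) (hne : e.1 ≠ e.2) (h : ¬ Follows Finset.univ e.2 e.1) :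
    ∃ f, T.Segment e f := by
  obtain ⟨Q, hQ, hf⟩ := T.exists_tile he hne h
  have h2 : 2 ≤ Q.card := by have := hQ.1; omega
  obtain ⟨c, hc⟩ := exists_precedes h2 hf.1
  obtain ⟨d, hd⟩ := exists_precedes h2 hc.1
  exact ⟨(c, d), Q, hQ, hf, hc, hd⟩

theorem Tiling.exists_segment_to {n : ℕ} (T : Tiling n) {e : Fin n × Fin n}
    (he : T.IsEdge e.1 e.2) (hne : e.1 ≠ e.2) (h : ¬ Follows Finset.univ e.1 e.2) :
    ∃ f, T.Segment f e := by
  obtain ⟨Q, hQ, hf⟩ := T.exists_tile he.symm hne.symm h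
  have h2 : 2 ≤ Q.card := by have := hQ.1; omega
  obtain ⟨a, ha⟩ := exists_follows h2 hf.2.1
  obtain ⟨b, hb⟩ := exists_follows h2 ha.2.1
  exact ⟨(a, b), Q, hQ, hb, ha, hf⟩

theorem exists_univ_follows {n : ℕ} (hn : 3 ≤ n) (x : Fin n) : ∃ y, Follows Finset.univ x y :=
  exists_follows (by simp; omega) (Finset.mem_univ x)

theorem exists_univ_precedes {n : ℕ} (hn : 3 ≤ n) (x : Fin n) : ∃ y, Follows Finset.univ y x :=
  exists_precedes (by simp; omega) (Finset.mem_univ x)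

/-- Exactly one strand starts at each vertex. -/
theorem Tiling.existsUnique_strand_from {n : ℕ} (hn : 3 ≤ n) (T : Tiling n) (x : Fin n) :
    ∃! y, T.Strand x y := by
  obtain ⟨x', hx⟩ := exists_univ_follows hn x
  obtain ⟨e, he, hend⟩ := exists_sink T.segment_left_unique (x, x')
    (fun y => T.no_segment_to hx)
  have hedge : T.IsEdge e.1 e.2 ∧ e.1 ≠ e.2 := by
    rcases he.cases_tail with h | ⟨f, -, h⟩
    · subst h
      exact ⟨Or.inr (Or.inl hx), hx.2.2.1⟩
    · exact h.isEdge.2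
  have hfol : Follows Finset.univ e.2 e.1 := by
    by_contra hcon
    obtain ⟨f, hf⟩ := T.exists_segment_from hedge.1 hedge.2 hcon
    exact hend f hf
  refine ⟨e.1, ⟨x', e.2, hx, hfol, he⟩, ?_⟩
  rintro y ⟨x'', y', hx'', hy, hpath⟩
  obtain rfl := hx.right_unique hx''
  rcases Relation.ReflTransGen.total_of_right_unique
    (fun a b c h h' => T.segment_right_unique a b c h h') he hpath with h | h
  · rcases h.cases_head with h | ⟨f, h, -⟩
    · rw [h]
    · exact absurd h (hend f)
  · rcases h.cases_head with h | ⟨f, h, -⟩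
    · rw [← h]
    · exact absurd h (T.no_segment_from hy)

/-- Exactly one strand ends at each vertex. -/
theorem Tiling.existsUnique_strand_to {n : ℕ} (hn : 3 ≤ n) (T : Tiling n) (y : Fin n) :
    ∃! x, T.Strand x y := by
  obtain ⟨y', hy⟩ := exists_univ_precedes hn y
  obtain ⟨e, he, hend⟩ := exists_sink (r := Function.swap T.Segment)
    (fun a b c h h' => T.segment_right_unique c a b h h') (y, y')
    (fun z => T.no_segment_from hy)
  have hedge : T.IsEdge e.1 e.2 ∧ e.1 ≠ e.2 := by
    rcases he.cases_tail with h | ⟨f, -, h⟩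
    · subst h
      exact ⟨Or.inr (Or.inr hy), hy.2.2.1.symm⟩
    · exact (Tiling.Segment.isEdge h).1
  have hfol : Follows Finset.univ e.1 e.2 := by
    by_contra hcon
    obtain ⟨f, hf⟩ := T.exists_segment_to hedge.1 hedge.2 hcon
    exact hend f hf
  refine ⟨e.1, ⟨e.2, y', hfol, hy, Relation.reflTransGen_swap.1 he⟩, ?_⟩
  rintro x ⟨x', y'', hx, hy'', hpath⟩
  obtain rfl := hy.left_unique hy''
  rcases Relation.ReflTransGen.total_of_right_unique
    (fun a b c h h' => T.segment_left_unique b c a h h') he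
    (Relation.reflTransGen_swap.2 hpath) with h | h
  · rcases h.cases_head with h | ⟨f, h, -⟩
    · rw [h]
    · exact absurd h (hend f)
  · rcases h.cases_head with h | ⟨f, h, -⟩
    · rw [← h]
    · exact absurd h (T.no_segment_to hx)

/-- The Scott permutation of a tiling of the `n`-gon, which sends the vertex at which a strand
starts to the vertex at which it ends. -/
noncomputable def scott {n : ℕ} (hn : 3 ≤ n) (T : Tiling n) : Equiv.Perm (Fin n) where
  toFun x := (T.existsUnique_strand_from hn x).choose
  invFun y := (T.existsUnique_strand_to hn y).choose
  left_inv x := ((T.existsUnique_strand_to hn _).choose_spec.2 x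
    (T.existsUnique_strand_from hn x).choose_spec.1).symm
  right_inv y := ((T.existsUnique_strand_from hn _).choose_spec.2 y
    (T.existsUnique_strand_to hn y).choose_spec.1).symm

theorem scott_apply_eq_iff {n : ℕ} (hn : 3 ≤ n) (T : Tiling n) (x y : Fin n) :
    scott hn T x = y ↔ T.Strand x y :=
  ⟨fun h => h ▸ (T.existsUnique_strand_from hn x).choose_spec.1,
    fun h => ((T.existsUnique_strand_from hn x).choose_spec.2 y h).symm⟩

/-- `T'` arises from `T` by a flip: `T` has two triangular tiles with the common side `[a, c]`, and
this diagonal is replaced by the other diagonal `[b, d]` of the quadrilateral they form. -/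
def Flip {n : ℕ} (T T' : Tiling n) : Prop :=
  ∃ a b c d, sbtw a b c ∧ sbtw c d a ∧ T.IsTile {a, b, c} ∧ T.IsTile {a, c, d} ∧
    T'.diagonals = insert s(b, d) (T.diagonals.erase s(a, c))

/-- Flip equivalence: the equivalence relation generated by flips. -/
def FlipEquiv {n : ℕ} : Tiling n → Tiling n → Prop := Relation.EqvGen Flip

end PolygonTiling

namespace PolygonTiling

/-! Everything passes through the large tiles, those with at least four vertices. Equal Scott
permutations force equal large tiles (`isTile_iff_of_scott_eq`), equal large tiles force flip
equivalence (`flipEquiv_of_isTile_iff`), and flips change neither the large tiles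
(`FlipEquiv.isTile_iff`) nor the permutation (`FlipEquiv.scott_eq`). The last point is local:
strands enter and leave the flipped quadrilateral at the same places before and after
(`FlipAt.ends`).

Large tiles to flips: let `[a, b]` be a diagonal of `T₂` missing from `T₁`. As the large tiles are
shared, `[a, b]` runs only through triangles of `T₁`. The crossing diagonal nearest to `a` can be
flipped to one that ends at `a`, which lowers the number of crossings (`Tiling.exists_flipAcross`).
Iterating creates `[a, b]` and loses no diagonal common to both tilings.

Permutation to large tiles: `isTile_iff_of_agree` is an induction on a polygon `S` bounded by edges
of both tilings, with strands stopped where they leave `S`. Shrinking `S` instead of `n` avoids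
relabelling vertices. Inside `S`, the first tiling has a tile with all sides but one on the boundary
(`Tiling.Closed.exists_ear_or_run`). If it is a triangle `p, v, q`, the strand from `p` ends at `q`;
in the second tiling this forces all tiles at `v` to be triangles (`Tiling.Ends.card_eq_three`), so
flips produce the same ear there, and `v` can be removed. If it has consecutive boundary vertices
`o, p, v, q`, the strand from `v` ends at `p`, which forces such a tile in the second tiling too
(`Tiling.Ends.exists_run`); the diagonal `[p, q]` is added to both and `v` is removed. Either
removal changes the ends of strands by a rule independent of the tiling, so agreement persists. -/

/-! ### Cyclic order -/

theorem Follows.restrict {n : ℕ} {S Q : Finset (Fin n)} {a b : Fin n} (h : Follows S a b)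
    (hQ : Q ⊆ S) (ha : a ∈ Q) (hb : b ∈ Q) : Follows Q a b :=
  ⟨ha, hb, h.2.2.1, fun k hk => h.2.2.2 k (hQ hk)⟩

theorem sbtw_or_sbtw {n : ℕ} {a b c : Fin n} (hab : a ≠ b) (hbc : b ≠ c) (hca : c ≠ a) :
    sbtw a b c ∨ sbtw c b a := by
  rw [Ne, Fin.ext_iff] at *
  rw [sbtw_iff_val, sbtw_iff_val]
  omega

theorem sbtw_rot {n : ℕ} {a b c : Fin n} (h : sbtw a b c) : sbtw b c a := by
  rw [sbtw_iff_val] at *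
  omega

theorem sbtw_distinct {n : ℕ} {a b c : Fin n} (h : sbtw a b c) : a ≠ b ∧ b ≠ c ∧ c ≠ a := by
  rw [sbtw_iff_val] at h
  simp only [Ne, Fin.ext_iff]
  omega

theorem sbtw_quad {n : ℕ} {a b c d : Fin n} (hb : sbtw a b c) (hd : sbtw c d a) :
    sbtw b c d ∧ sbtw d a b := by
  simp only [sbtw_iff_cw a, cw_self] at *
  omega

theorem Follows.sbtw_of_mem {n : ℕ} {S : Finset (Fin n)} {a b k : Fin n} (h : Follows S a b)
    (hk : k ∈ S) (hka : k ≠ a) (hkb : k ≠ b) : sbtw a b k := by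
  rcases sbtw_or_sbtw hka.symm hkb h.2.2.1.symm with h' | h'
  · exact absurd h' (h.2.2.2 k hk)
  · exact sbtw_rot (sbtw_rot h')

/-! ### Triangles -/

theorem triple_rot {n : ℕ} (a b c : Fin n) : ({a, b, c} : Finset (Fin n)) = {b, c, a} := by
  ext x
  simp only [Finset.mem_insert, Finset.mem_singleton]
  tauto

theorem card_triple {n : ℕ} {a b c : Fin n} (h : sbtw a b c) :
    ({a, b, c} : Finset (Fin n)).card = 3 := by
  obtain ⟨h1, h2, h3⟩ := sbtw_distinct h
  exact Finset.card_eq_three.2 ⟨a, b, c, h1, h3.symm, h2, rfl⟩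

theorem follows_triple {n : ℕ} {a b c : Fin n} (h : sbtw a b c) : Follows {a, b, c} a b := by
  refine ⟨by simp, by simp, (sbtw_distinct h).1, fun k hk hs => ?_⟩
  simp only [Finset.mem_insert, Finset.mem_singleton] at hk
  rw [sbtw_iff_val] at h hs
  rcases hk with rfl | rfl | rfl <;> omega

theorem follows_triple₂ {n : ℕ} {a b c : Fin n} (h : sbtw a b c) : Follows {a, b, c} b c := by
  rw [triple_rot]
  exact follows_triple (sbtw_rot h)

theorem follows_triple₃ {n : ℕ} {a b c : Fin n} (h : sbtw a b c) : Follows {a, b, c} c a := by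
  rw [triple_rot, triple_rot]
  exact follows_triple (sbtw_rot (sbtw_rot h))

/-- The sides of a triangle. -/
theorem follows_triple_cases {n : ℕ} {a b c x y : Fin n} (h : sbtw a b c)
    (hf : Follows {a, b, c} x y) : (x = a ∧ y = b) ∨ (x = b ∧ y = c) ∨ (x = c ∧ y = a) := by
  have hx := hf.1
  simp only [Finset.mem_insert, Finset.mem_singleton] at hx
  rcases hx with rfl | rfl | rfl
  · exact Or.inl ⟨rfl, hf.right_unique (follows_triple h)⟩
  · exact Or.inr (Or.inl ⟨rfl, hf.right_unique (follows_triple₂ h)⟩)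
  · exact Or.inr (Or.inr ⟨rfl, hf.right_unique (follows_triple₃ h)⟩)

theorem sbtw_of_follows {n : ℕ} {Q : Finset (Fin n)} (hQ : 3 ≤ Q.card) {a b c : Fin n}
    (h : Follows Q a b) (h' : Follows Q c a) : sbtw a b c := by
  refine h.sbtw_of_mem h'.1 h'.2.2.1 ?_
  rintro rfl
  exact h.not_both hQ h'

theorem sbtw_of_follows' {n : ℕ} {Q : Finset (Fin n)} (hQ : 3 ≤ Q.card) {a b c : Fin n}
    (h : Follows Q a b) (h' : Follows Q b c) : sbtw a b c :=
  sbtw_rot (sbtw_rot (sbtw_of_follows hQ h' h))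

theorem eq_triple {n : ℕ} {Q : Finset (Fin n)} (hQ : Q.card = 3) {a b c : Fin n}
    (h : Follows Q a b) (h' : Follows Q c a) : Q = {a, b, c} := by
  have hs := sbtw_of_follows hQ.ge h h'
  symm
  apply Finset.eq_of_subset_of_card_le
  · intro x hx
    simp only [Finset.mem_insert, Finset.mem_singleton] at hx
    rcases hx with rfl | rfl | rfl
    exacts [h.1, h.2.1, h'.1]
  · rw [card_triple hs, hQ]

theorem eq_triple_of_follows {n : ℕ} {Q : Finset (Fin n)} {a b c : Fin n} (h1 : Follows Q a b)
    (h2 : Follows Q b c) (h3 : Follows Q c a) : Q = {a, b, c} := by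
  ext k
  simp only [Finset.mem_insert, Finset.mem_singleton]
  constructor
  · intro hk
    by_contra hne
    simp only [not_or, Fin.ext_iff] at hne
    have a1 := h1.2.2.2 k hk
    have a2 := h2.2.2.2 k hk
    have a3 := h3.2.2.2 k hk
    have b1 := h1.2.2.2 c h2.2.1
    have c1 := h1.2.2.1
    have c2 := h2.2.2.1
    have c3 := h3.2.2.1
    rw [Ne, Fin.ext_iff] at c1 c2 c3
    rw [sbtw_iff_val] at a1 a2 a3 b1
    omega
  · rintro (rfl | rfl | rfl)
    exacts [h1.1, h2.1, h3.1]

theorem Tiling.isTile_triple {n : ℕ} {T : Tiling n} {a b c : Fin n} (h : sbtw a b c)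
    (h1 : T.IsEdge a b) (h2 : T.IsEdge b c) (h3 : T.IsEdge c a) : T.IsTile {a, b, c} := by
  refine ⟨(card_triple h).ge, fun x y hf => ?_, fun x hx y hy hD => ?_⟩
  · rcases follows_triple_cases h hf with ⟨rfl, rfl⟩ | ⟨rfl, rfl⟩ | ⟨rfl, rfl⟩ <;> assumption
  · have hne := (T.isDiagonal x y hD).1
    have f1 := follows_triple h
    have f2 := follows_triple₂ h
    have f3 := follows_triple₃ h
    generalize ({a, b, c} : Finset (Fin n)) = Q at f1 f2 f3 hx hy ⊢
    have hQ := eq_triple_of_follows f1 f2 f3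
    rw [hQ] at hx hy
    simp only [Finset.mem_insert, Finset.mem_singleton] at hx hy
    rcases hx with rfl | rfl | rfl <;> rcases hy with rfl | rfl | rfl <;> tauto

/-! ### Tiles and edges -/

/-- Otherwise `s` lies behind a side of the tile, and that side crosses `[s, t]`. -/
theorem Tiling.IsTile.mem_of_separated {n : ℕ} {T : Tiling n} {Q : Finset (Fin n)}
    (hQ : T.IsTile Q) {s t x y : Fin n} (hE : T.IsEdge s t) (hx : x ∈ Q) (hy : y ∈ Q)
    (h1 : sbtw s x t) (h2 : sbtw t y s) : s ∈ Q := by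
  by_contra hs
  obtain ⟨u, w, hf, hg⟩ := exists_gap (by have := hQ.1; omega) hs
  refine (hQ.2.1 u w hf).not_cross hE hg ?_
  have a1 := hf.2.2.2 x hx
  have a2 := hf.2.2.2 y hy
  rw [sbtw_iff_cw s] at *
  rw [cw_self] at *
  omega

/-- A tile does not have vertices strictly on either side of an edge of the tiling. -/
theorem Tiling.IsTile.one_side {n : ℕ} {T : Tiling n} {Q : Finset (Fin n)}
    (hQ : T.IsTile Q) {s t x y : Fin n} (hE : T.IsEdge s t) (hx : x ∈ Q) (hy : y ∈ Q)
    (h1 : sbtw s x t) (h2 : sbtw t y s) : False := by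
  have hs := hQ.mem_of_separated hE hx hy h1 h2
  have ht := hQ.mem_of_separated hE.symm hy hx h2 h1
  -- The separating edge joins two vertices of the tile, so it is a side of it and has the whole
  -- tile on one side.
  rcases hQ.2.2 s hs t ht (hE.diag h1 h2) with h | h
  · exact h.2.2.2 x hx h1
  · exact h.2.2.2 y hy h2

theorem Tiling.IsEdge.ne {n : ℕ} {T : Tiling n} {a b : Fin n} (h : T.IsEdge a b) : a ≠ b := by
  rcases h with h | h | h
  exacts [(T.isDiagonal a b h).1, h.2.2.1, h.2.2.1.symm]

theorem Tiling.eq_of_diagonals {n : ℕ} {T T' : Tiling n} (h : T.diagonals = T'.diagonals) :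
    T = T' := by
  cases T
  cases T'
  cases h
  rfl

theorem Tiling.not_follows_of_sbtw {n : ℕ} {a b c : Fin n} (h : sbtw a b c) :
    ¬ Follows Finset.univ a c := fun h' => h'.2.2.2 b (Finset.mem_univ _) h

/-- The tiling with one more diagonal. -/
def Tiling.addDiagonal {n : ℕ} (T : Tiling n) (a c b d : Fin n) (hb : sbtw a b c) (hd : sbtw c d a)
    (h : ∀ x y, s(x, y) ∈ T.diagonals → sbtw a x c → sbtw c y a → False) : Tiling n where
  diagonals := insert s(a, c) T.diagonals
  isDiagonal x y hxy := by
    rw [Finset.mem_insert, Sym2.eq_iff] at hxy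
    have h1 := Tiling.not_follows_of_sbtw hb
    have h2 := Tiling.not_follows_of_sbtw hd
    have h3 := (sbtw_distinct hb).2.2
    rcases hxy with (⟨rfl, rfl⟩ | ⟨rfl, rfl⟩) | hxy
    · exact ⟨h3.symm, h1, h2⟩
    · exact ⟨h3, h2, h1⟩
    · exact T.isDiagonal x y hxy
  noncrossing x y z w hxy hzw := by
    rintro ⟨h1, h2⟩
    rw [Finset.mem_insert, Sym2.eq_iff] at hxy hzw
    have irr : ∀ {u v : Fin n}, ¬ sbtw u u v := fun h => (sbtw_distinct h).1 rfl
    have irr' : ∀ {u v : Fin n}, ¬ sbtw u v v := fun h => (sbtw_distinct h).2.1 rfl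
    rcases hxy with (⟨rfl, rfl⟩ | ⟨rfl, rfl⟩) | hxy
    · rcases hzw with (⟨rfl, rfl⟩ | ⟨rfl, rfl⟩) | hzw
      · exact irr h1
      · exact irr' h1
      · exact h z w hzw h1 h2
    · rcases hzw with (⟨rfl, rfl⟩ | ⟨rfl, rfl⟩) | hzw
      · exact irr' h1
      · exact irr h1
      · exact h w z (Sym2.eq_swap ▸ hzw) h2 h1
    · rcases hzw with (⟨rfl, rfl⟩ | ⟨rfl, rfl⟩) | hzw
      · exact h y x (Sym2.eq_swap ▸ hxy) (sbtw_quad h1 h2).1 (sbtw_quad h1 h2).2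
      · exact h x y hxy (sbtw_quad h1 h2).2 (sbtw_quad h1 h2).1
      · exact T.noncrossing x y z w hxy hzw ⟨h1, h2⟩

/-- The tiling with fewer diagonals. -/
def Tiling.eraseDiagonal {n : ℕ} (T : Tiling n) (e : Sym2 (Fin n)) : Tiling n where
  diagonals := T.diagonals.erase e
  isDiagonal x y hxy := T.isDiagonal x y (Finset.mem_of_mem_erase hxy)
  noncrossing x y z w hxy hzw :=
    T.noncrossing x y z w (Finset.mem_of_mem_erase hxy) (Finset.mem_of_mem_erase hzw)

/-! ### Flips -/

/-- `T'` arises from `T` by replacing the diagonal `[a, c]` of the quadrilateral `a`, `b`, `c`, `d`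
by the diagonal `[b, d]`. -/
structure FlipAt {n : ℕ} (T T' : Tiling n) (a b c d : Fin n) : Prop where
  hb : sbtw a b c
  hd : sbtw c d a
  tile : T.IsTile {a, b, c}
  tile' : T.IsTile {a, c, d}
  diagonals : T'.diagonals = insert s(b, d) (T.diagonals.erase s(a, c))

theorem flip_iff {n : ℕ} {T T' : Tiling n} : Flip T T' ↔ ∃ a b c d, FlipAt T T' a b c d :=
  ⟨fun ⟨a, b, c, d, h1, h2, h3, h4, h5⟩ => ⟨a, b, c, d, h1, h2, h3, h4, h5⟩,
    fun ⟨a, b, c, d, h1, h2, h3, h4, h5⟩ => ⟨a, b, c, d, h1, h2, h3, h4, h5⟩⟩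

theorem FlipAt.isEdge_ac {n : ℕ} {T T' : Tiling n} {a b c d : Fin n} (h : FlipAt T T' a b c d) :
    T.IsEdge a c :=
  (h.tile.2.1 c a (follows_triple₃ h.hb)).symm

theorem FlipAt.mem_ac {n : ℕ} {T T' : Tiling n} {a b c d : Fin n} (h : FlipAt T T' a b c d) :
    s(a, c) ∈ T.diagonals :=
  h.isEdge_ac.diag h.hb h.hd

theorem FlipAt.notMem_bd {n : ℕ} {T T' : Tiling n} {a b c d : Fin n} (h : FlipAt T T' a b c d) :
    s(b, d) ∉ T.diagonals := by
  intro h'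
  exact T.noncrossing a c b d h.mem_ac h' ⟨h.hb, h.hd⟩

theorem FlipAt.isEdge_bd {n : ℕ} {T T' : Tiling n} {a b c d : Fin n} (h : FlipAt T T' a b c d) :
    T'.IsEdge b d := by
  left
  rw [h.diagonals]
  exact Finset.mem_insert_self _ _

theorem FlipAt.isEdge {n : ℕ} {T T' : Tiling n} {a b c d x y : Fin n} (h : FlipAt T T' a b c d)
    (hE : T.IsEdge x y) (hne : s(x, y) ≠ s(a, c)) : T'.IsEdge x y := by
  rcases hE with hE | hE
  · left
    rw [h.diagonals]
    exact Finset.mem_insert_of_mem (Finset.mem_erase.2 ⟨hne, hE⟩)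
  · exact Or.inr hE

theorem FlipAt.not_isEdge_ac {n : ℕ} {T T' : Tiling n} {a b c d : Fin n}
    (h : FlipAt T T' a b c d) : ¬ T'.IsEdge a c :=
  fun h' => h'.not_cross h.isEdge_bd h.hb h.hd

/-- The four sides of the quadrilateral survive the flip and bound two triangles with `[b, d]`; the
inverse flip is the same configuration with its labels rotated. -/
theorem FlipAt.symm {n : ℕ} {T T' : Tiling n} {a b c d : Fin n} (h : FlipAt T T' a b c d) :
    FlipAt T' T b c d a := by
  obtain ⟨q1, q2⟩ := sbtw_quad h.hb h.hd
  obtain ⟨n1, n2, n3⟩ := sbtw_distinct h.hb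
  obtain ⟨n4, n5, n6⟩ := sbtw_distinct h.hd
  obtain ⟨n7, n8, n9⟩ := sbtw_distinct q1
  have e1 := h.isEdge (h.tile.2.1 a b (follows_triple h.hb))
    (by rw [Ne, Sym2.eq_iff]; tauto)
  have e2 := h.isEdge (h.tile.2.1 b c (follows_triple₂ h.hb))
    (by rw [Ne, Sym2.eq_iff]; tauto)
  have hs : sbtw a c d := sbtw_rot (sbtw_rot h.hd)
  have e3 := h.isEdge (h.tile'.2.1 c d (follows_triple₂ hs))
    (by rw [Ne, Sym2.eq_iff]; tauto)
  have e4 := h.isEdge (h.tile'.2.1 d a (follows_triple₃ hs))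
    (by rw [Ne, Sym2.eq_iff]; tauto)
  refine ⟨q1, q2, Tiling.isTile_triple q1 e2 e3 h.isEdge_bd.symm,
    Tiling.isTile_triple (sbtw_rot (sbtw_rot q2)) h.isEdge_bd e4 e1, ?_⟩
  rw [h.diagonals, Finset.erase_insert
    (fun h' => h.notMem_bd (Finset.mem_of_mem_erase h')), Sym2.eq_swap,
    Finset.insert_erase h.mem_ac]

/-- A flip does not affect the other tiles. -/
theorem FlipAt.isTile {n : ℕ} {T T' : Tiling n} {a b c d : Fin n} (h : FlipAt T T' a b c d)
    {Q : Finset (Fin n)} (hQ : T.IsTile Q) (h1 : Q ≠ {a, b, c}) (h2 : Q ≠ {a, c, d}) :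
    T'.IsTile Q := by
  refine ⟨hQ.1, fun x y hf => h.isEdge (hQ.2.1 x y hf) ?_, fun x hx y hy hD => ?_⟩
  · rw [Ne, Sym2.eq_iff]
    rintro (⟨rfl, rfl⟩ | ⟨rfl, rfl⟩)
    · exact h2 (hQ.unique h.tile' hf (follows_triple (sbtw_rot (sbtw_rot h.hd))))
    · exact h1 (hQ.unique h.tile hf (follows_triple₃ h.hb))
  · rw [h.diagonals, Finset.mem_insert, Sym2.eq_iff] at hD
    rcases hD with (⟨rfl, rfl⟩ | ⟨rfl, rfl⟩) | hD
    · exact (hQ.one_side h.isEdge_ac hx hy h.hb h.hd).elim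
    · exact (hQ.one_side h.isEdge_ac hy hx h.hb h.hd).elim
    · exact hQ.2.2 x hx y hy (Finset.mem_of_mem_erase hD)

theorem FlipAt.isTile_iff {n : ℕ} {T T' : Tiling n} {a b c d : Fin n} (h : FlipAt T T' a b c d)
    {Q : Finset (Fin n)} (hQ : 4 ≤ Q.card) : T.IsTile Q ↔ T'.IsTile Q := by
  have aux : ∀ {T T' : Tiling n} {a b c d : Fin n}, FlipAt T T' a b c d → T.IsTile Q →
      T'.IsTile Q := by
    intro T T' a b c d h hT
    refine h.isTile hT ?_ ?_ <;> rintro rfl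
    · rw [card_triple h.hb] at hQ; omega
    · rw [card_triple (sbtw_rot (sbtw_rot h.hd))] at hQ; omega
  exact ⟨aux h, aux h.symm⟩

theorem Flip.isTile_iff {n : ℕ} {T T' : Tiling n} (h : Flip T T') {Q : Finset (Fin n)}
    (hQ : 4 ≤ Q.card) : T.IsTile Q ↔ T'.IsTile Q := by
  obtain ⟨a, b, c, d, h⟩ := flip_iff.1 h
  exact h.isTile_iff hQ

/-- The common side of two triangles can be flipped. -/
theorem Tiling.exists_flipAt {n : ℕ} {T : Tiling n} {a b c d : Fin n} (hb : sbtw a b c)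
    (hd : sbtw c d a) (h : T.IsTile {a, b, c}) (h' : T.IsTile {a, c, d}) :
    ∃ T', FlipAt T T' a b c d := by
  obtain ⟨q1, q2⟩ := sbtw_quad hb hd
  refine ⟨(T.eraseDiagonal s(a, c)).addDiagonal b d c a q1 q2 ?_, hb, hd, h, h', rfl⟩
  intro x y hxy hx hy
  have hxy := Finset.mem_erase.1 hxy
  have hE : T.IsEdge x y := Or.inl hxy.2
  have key : ∀ {Q : Finset (Fin n)}, T.IsTile Q → ∀ u ∈ Q, ∀ v ∈ Q, ¬ (sbtw x u y ∧ sbtw y v x) :=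
    fun hQ u hu v hv hs => hQ.one_side hE hu hv hs.1 hs.2
  have k1 := key h a (by simp) b (by simp)
  have k2 := key h c (by simp) b (by simp)
  have k3 := key h' d (by simp) c (by simp)
  have k4 := key h' d (by simp) a (by simp)
  -- The only edge that could separate `b` from `d` without separating vertices of one of the two
  -- triangles is `[a, c]`, which has been erased.
  have hne : ¬ (x = c ∧ y = a) := by
    rintro ⟨rfl, rfl⟩
    exact hxy.1 Sym2.eq_swap
  rw [← cw_inj (o := b), ← cw_inj (o := b) (a := y)] at hne
  clear hE key hxy h h'
  simp only [sbtw_iff_cw b, cw_self] at *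
  have o1 : cw b c < cw b d ∧ cw b d < cw b a ∧ 0 < cw b c := by
    clear k1 k2 k3 k4 hne hx hy q1 q2
    omega
  clear hb hd q1 q2
  have o2 : 0 < cw b x ∧ cw b x < cw b d := by
    clear k1 k2 k3 k4 hne hy
    omega
  have o3 : cw b d < cw b y := by
    clear k1 k2 k3 k4 hne hx
    omega
  clear hx hy
  rcases lt_trichotomy (cw b x) (cw b c) with h1 | h1 | h1
  · clear k1 k3 k4
    omega
  · rcases lt_trichotomy (cw b y) (cw b a) with h2 | h2 | h2
    · clear k1 k2 k3
      omega
    · exact hne ⟨h1, h2⟩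
    · clear k2 k3 k4
      omega
  · clear k1 k2 k4
    omega

/-! ### Reaching a diagonal by flips -/

/-- The tile at `a` into which the segment `[a, b]` starts: the edges at `a` are ordered by angle,
and `[a, b]` falls strictly between two consecutive ones. -/
theorem Tiling.exists_opening {n : ℕ} (T : Tiling n) {a b : Fin n} (hab : a ≠ b)
    (hE : ¬ T.IsEdge a b) :
    ∃ Q p q, T.IsTile Q ∧ Follows Q a p ∧ Follows Q q a ∧ sbtw a p b ∧ sbtw b q a := by
  classical
  obtain ⟨p₀, hp₀⟩ := exists_follows (S := (Finset.univ : Finset (Fin n))) (a := a) (by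
    rw [← Finset.card_pair hab]
    exact Finset.card_le_card (Finset.subset_univ _)) (Finset.mem_univ a)
  have hs₀ : sbtw a p₀ b := hp₀.sbtw_of_mem (Finset.mem_univ b) hab.symm (by
    rintro rfl
    exact hE (Or.inr (Or.inl hp₀)))
  -- The last edge at `a` before `b`; maximality places the other neighbour of `a` in the next tile
  -- beyond `b`.
  obtain ⟨p, hp, hmax⟩ := Finset.exists_max_image
    (Finset.univ.filter fun p => T.IsEdge a p ∧ sbtw a p b) (cw a)
    ⟨p₀, by simp only [Finset.mem_filter, Finset.mem_univ, true_and]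
            exact ⟨Or.inr (Or.inl hp₀), hs₀⟩⟩
  simp only [Finset.mem_filter, Finset.mem_univ, true_and] at hp hmax
  obtain ⟨hp1, hp2⟩ := hp
  obtain ⟨Q, hQ, hf⟩ := T.exists_tile hp1 hp1.ne
    (Tiling.not_follows_of_sbtw (sbtw_rot hp2))
  obtain ⟨q, hq⟩ := exists_precedes (by have := hQ.1; omega) hf.1
  refine ⟨Q, p, q, hQ, hf, hq, hp2, ?_⟩
  have hE' := (hQ.2.1 q a hq).symm
  have hqb : q ≠ b := by
    rintro rfl
    exact hE hE'
  have hqp := sbtw_of_follows hQ.1 hf hq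
  rcases sbtw_or_sbtw hqb.symm hq.2.2.1 hab with h | h
  · exact h
  · have := hmax q ⟨hE', h⟩
    rw [sbtw_iff_cw a, cw_self] at hqp
    omega

/-- A flip that preserves the edges that do not cross `[a, b]`. -/
def FlipAcross {n : ℕ} (a b : Fin n) (T T' : Tiling n) : Prop :=
  Flip T T' ∧ ∀ x y, T.IsEdge x y → ¬ (sbtw a x b ∧ sbtw b y a) → ¬ (sbtw a y b ∧ sbtw b x a) →
    T'.IsEdge x y

/-- The number of diagonals that cross `[a, b]`. -/
noncomputable def Tiling.crossings {n : ℕ} (T : Tiling n) (a b : Fin n) : ℕ := by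
  classical
  exact (T.diagonals.filter fun e => ∃ x y, e = s(x, y) ∧ sbtw a x b ∧ sbtw b y a).card

/-- If no tile of size at least `4` has vertices strictly on either side of `[a, b]`, but `[a, b]`
is not an edge, then one of the diagonals that cross it can be flipped so that it does not cross
it any more. -/
theorem Tiling.exists_flipAcross {n : ℕ} (T : Tiling n) {a b : Fin n} (hab : a ≠ b)
    (hE : ¬ T.IsEdge a b) (H : ∀ Q, T.IsTile Q → 4 ≤ Q.card → ∀ x ∈ Q, ∀ y ∈ Q, sbtw a x b →
      sbtw b y a → False) : ∃ T', FlipAcross a b T T' ∧ T'.crossings a b < T.crossings a b := by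
  classical
  obtain ⟨Q, p, q, hQ, hp, hq, hsp, hsq⟩ := T.exists_opening hab hE
  -- This applies to the tiles on both sides of `[p, q]`, so that edge is flippable.
  have tri : ∀ Q, T.IsTile Q → p ∈ Q → q ∈ Q → Q.card = 3 := by
    intro Q hQ hp hq
    by_contra hne
    have := hQ.1
    exact H Q hQ (by omega) p hp q hq hsp hsq
  have hpq := sbtw_of_follows hQ.1 hp hq
  have hQe := eq_triple (tri Q hQ hp.2.1 hq.1) hp hq
  have hEpq : T.IsEdge p q := hQ.2.1 p q (by rw [hQe]; exact follows_triple₂ hpq)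
  have hpbq : sbtw p b q := by
    rw [sbtw_iff_cw a, cw_self] at *
    omega
  obtain ⟨Q', hQ', hf⟩ := T.exists_tile hEpq.symm hEpq.ne.symm
    (Tiling.not_follows_of_sbtw hpbq)
  obtain ⟨r, hr⟩ := exists_precedes (by have := hQ'.1; omega) hf.1
  have hqpr := sbtw_of_follows hQ'.1 hf hr
  have hQe' := eq_triple (tri Q' hQ' hf.2.1 hf.1) hf hr
  -- The new diagonal `[r, a]` ends at `a` and so does not cross `[a, b]`, whereas `[p, q]` does.
  obtain ⟨T', hT'⟩ := T.exists_flipAt (a := p) (b := r) (c := q) (d := a) (sbtw_rot hqpr)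
    (sbtw_rot (sbtw_rot hpq)) (by rw [← triple_rot, ← hQe']; exact hQ')
    (by rw [← triple_rot, ← hQe]; exact hQ)
  refine ⟨T', ⟨flip_iff.2 ⟨_, _, _, _, hT'⟩, fun x y hxy h1 h2 => hT'.isEdge hxy ?_⟩, ?_⟩
  · rw [Ne, Sym2.eq_iff]
    rintro (⟨rfl, rfl⟩ | ⟨rfl, rfl⟩)
    · exact h1 ⟨hsp, hsq⟩
    · exact h2 ⟨hsp, hsq⟩
  · unfold Tiling.crossings
    apply Finset.card_lt_card
    rw [Finset.ssubset_iff_of_subset]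
    · refine ⟨s(p, q), ?_, ?_⟩
      · exact Finset.mem_filter.2 ⟨hT'.mem_ac, p, q, rfl, hsp, hsq⟩
      · intro h
        exact hT'.not_isEdge_ac (Or.inl (Finset.mem_filter.1 h).1)
    · intro e he
      rw [Finset.mem_filter] at he ⊢
      refine ⟨?_, he.2⟩
      obtain ⟨he, x, y, rfl, hx, hy⟩ := he
      rw [hT'.diagonals, Finset.mem_insert, Sym2.eq_iff] at he
      rcases he with (⟨rfl, rfl⟩ | ⟨rfl, rfl⟩) | he
      · exact ((sbtw_distinct hy).2.1 rfl).elim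
      · exact ((sbtw_distinct hx).1 rfl).elim
      · exact Finset.mem_of_mem_erase he

/-- Induction on the number of crossings; the hypothesis survives each flip because it concerns only
large tiles. -/
theorem Tiling.exists_reach_edge {n : ℕ} {a b : Fin n} (hab : a ≠ b) (T : Tiling n)
    (H : ∀ Q, T.IsTile Q → 4 ≤ Q.card → ∀ x ∈ Q, ∀ y ∈ Q, sbtw a x b → sbtw b y a → False) :
    ∃ T', Relation.ReflTransGen (FlipAcross a b) T T' ∧ T'.IsEdge a b := by
  induction hm : T.crossings a b using Nat.strong_induction_on generalizing T with
  | _ m ih =>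
    by_cases hE : T.IsEdge a b
    · exact ⟨T, .refl, hE⟩
    · obtain ⟨T', hT', hlt⟩ := T.exists_flipAcross hab hE H
      obtain ⟨T'', h1, h2⟩ := ih _ (hm ▸ hlt) T'
        (fun Q hQ hc => H Q ((hT'.1.isTile_iff hc).2 hQ) hc) rfl
      exact ⟨T'', .head hT' h1, h2⟩

theorem FlipAcross.isTile_iff {n : ℕ} {a b : Fin n} {T T' : Tiling n}
    (h : Relation.ReflTransGen (FlipAcross a b) T T') {Q : Finset (Fin n)} (hQ : 4 ≤ Q.card) :
    T.IsTile Q ↔ T'.IsTile Q := by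
  induction h with
  | refl => rfl
  | tail _ h ih => exact ih.trans (h.1.isTile_iff hQ)

theorem FlipAcross.flipEquiv {n : ℕ} {a b : Fin n} {T T' : Tiling n}
    (h : Relation.ReflTransGen (FlipAcross a b) T T') : FlipEquiv T T' := by
  induction h with
  | refl => exact .refl _
  | tail _ h ih => exact ih.trans _ _ _ (.rel _ _ h.1)

theorem FlipAcross.isEdge {n : ℕ} {a b : Fin n} {T T' : Tiling n}
    (h : Relation.ReflTransGen (FlipAcross a b) T T') {x y : Fin n} (hE : T.IsEdge x y)
    (h1 : ¬ (sbtw a x b ∧ sbtw b y a)) (h2 : ¬ (sbtw a y b ∧ sbtw b x a)) : T'.IsEdge x y := by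
  induction h with
  | refl => exact hE
  | tail _ h ih => exact h.2 x y ih h1 h2

theorem FlipEquiv.isTile_iff {n : ℕ} {T T' : Tiling n} (h : FlipEquiv T T') {Q : Finset (Fin n)}
    (hQ : 4 ≤ Q.card) : T.IsTile Q ↔ T'.IsTile Q := by
  induction h with
  | rel _ _ h => exact h.isTile_iff hQ
  | refl => rfl
  | symm _ _ _ ih => exact ih.symm
  | trans _ _ _ _ _ ih ih' => exact ih.trans ih'

/-! ### Large tiles determine the flip class -/

/-- Tilings with the same tiles of size at least `4` are flip equivalent. -/
theorem flipEquiv_of_isTile_iff {n : ℕ} (T₂ T₁ : Tiling n)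
    (H : ∀ Q : Finset (Fin n), 4 ≤ Q.card → (T₁.IsTile Q ↔ T₂.IsTile Q)) : FlipEquiv T₁ T₂ := by
  classical
  induction hm : (T₂.diagonals \ T₁.diagonals).card using Nat.strong_induction_on
    generalizing T₁ with
  | _ m ih =>
    by_cases hsub : T₂.diagonals ⊆ T₁.diagonals
    · suffices h : T₁.diagonals ⊆ T₂.diagonals by
        rw [Tiling.eq_of_diagonals (h.antisymm hsub)]
        exact .refl _
      intro e
      induction e using Sym2.ind with
      | _ a b =>
        intro he
        by_contra he'
        have hd := T₁.isDiagonal a b he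
        -- A surplus diagonal of `T₁` would cut through a tile of `T₂`: a large one is also a tile
        -- of `T₁`, and a triangle has its far side in `T₁`; both are impossible.
        obtain ⟨Q, p, q, hQ, hp, hq, hsp, hsq⟩ := T₂.exists_opening hd.1 (by
          rintro (h | h | h)
          exacts [he' h, hd.2.1 h, hd.2.2 h])
        by_cases hc : 4 ≤ Q.card
        · exact ((H Q hc).2 hQ).one_side (Or.inl he) hp.2.1 hq.1 hsp hsq
        · have hc3 : Q.card = 3 := by have := hQ.1; omega
          have hE : T₂.IsEdge p q := hQ.2.1 p q (by
            rw [eq_triple hc3 hp hq]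
            exact follows_triple₂ (sbtw_of_follows hQ.1 hp hq))
          have hE1 : T₁.IsEdge p q := hE.imp (fun h => hsub h) id
          exact Tiling.IsEdge.not_cross (T := T₁) (Or.inl he) hE1 hsp hsq
    · obtain ⟨e, he, he'⟩ := Finset.not_subset.1 hsub
      induction e using Sym2.ind with
      | _ a b =>
        have hd := T₂.isDiagonal a b he
        obtain ⟨T', hT', hE⟩ := Tiling.exists_reach_edge hd.1 T₁ (fun Q hQ hc x hx y hy h1 h2 =>
          ((H Q hc).1 hQ).one_side (Or.inl he) hx hy h1 h2)
        have hmem : ∀ {x y}, T'.IsEdge x y → s(x, y) ∈ T₂.diagonals → s(x, y) ∈ T'.diagonals := by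
          intro x y h h'
          have hd := T₂.isDiagonal x y h'
          rcases h with h | h | h
          exacts [h, (hd.2.1 h).elim, (hd.2.2 h).elim]
        refine (FlipAcross.flipEquiv hT').trans _ _ _ (ih _ ?_ T'
          (fun Q hQ => (FlipAcross.isTile_iff hT' hQ).symm.trans (H Q hQ)) rfl)
        rw [← hm]
        apply Finset.card_lt_card
        rw [Finset.ssubset_iff_of_subset]
        · refine ⟨s(a, b), Finset.mem_sdiff.2 ⟨he, he'⟩, fun h => ?_⟩
          exact (Finset.mem_sdiff.1 h).2 (hmem hE he)
        · intro f
          induction f using Sym2.ind with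
          | _ x y =>
            intro hf
            rw [Finset.mem_sdiff] at hf ⊢
            -- A common diagonal does not cross `[a, b]`, since both belong to `T₂`; hence the flips
            -- keep it.
            refine ⟨hf.1, fun h => hf.2 (hmem (FlipAcross.isEdge hT' (Or.inl h) ?_ ?_) hf.1)⟩
            · exact T₂.noncrossing a b x y he hf.1
            · exact T₂.noncrossing a b y x he (Sym2.eq_swap ▸ hf.1)

/-! ### Strands in a polygon formed by edges of a tiling -/

/-- The sides of the polygon with vertex set `S` are edges of the tiling. -/
def Tiling.Closed {n : ℕ} (T : Tiling n) (S : Finset (Fin n)) : Prop :=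
  ∀ a b, Follows S a b → T.IsEdge a b

/-- `T.Ends S a b y`: after crossing the edge `[a, b]` near `a`, the strand leaves the polygon with
vertex set `S` near `y`. -/
inductive Tiling.Ends {n : ℕ} (T : Tiling n) (S : Finset (Fin n)) : Fin n → Fin n → Fin n → Prop
  | exit {a b : Fin n} : Follows S b a → Tiling.Ends T S a b a
  | step {a b c d y : Fin n} {Q : Finset (Fin n)} : T.IsTile Q → Q ⊆ S → Follows Q a b →
      Follows Q c a → Follows Q d c → Tiling.Ends T S c d y → Tiling.Ends T S a b y

theorem Tiling.closed_univ {n : ℕ} (T : Tiling n) : T.Closed Finset.univ :=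
  fun _ _ h => Or.inr (Or.inl h)

/-- The side of `S` that cuts off `z` is an edge, so the whole tile stays behind it and can meet `S`
only in the two ends of that side. -/
theorem Tiling.Closed.exists_gap {n : ℕ} {T : Tiling n} {S Q : Finset (Fin n)} (hS : T.Closed S)
    (hc : 2 ≤ S.card) (hQ : T.IsTile Q) {z : Fin n} (hz : z ∈ Q) (hzS : z ∉ S) :
    ∃ s t, Follows S s t ∧ sbtw s z t ∧ ∀ k ∈ Q, ¬ sbtw t k s := by
  obtain ⟨s, t, hf, hs⟩ := PolygonTiling.exists_gap hc hzS
  exact ⟨s, t, hf, hs, fun k hk hk' => hQ.one_side (hS s t hf) hz hk hs hk'⟩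

theorem Follows.eq_or_eq {n : ℕ} {S Q : Finset (Fin n)} {s t k : Fin n} (h : Follows S s t)
    (hQ : ∀ k ∈ Q, ¬ sbtw t k s) (hk : k ∈ Q) (hkS : k ∈ S) : k = s ∨ k = t := by
  by_contra hne
  rw [not_or] at hne
  exact hQ k hk (sbtw_rot (h.sbtw_of_mem hkS hne.1 hne.2))

theorem Tiling.Closed.subset_of_follows {n : ℕ} {T : Tiling n} {S Q : Finset (Fin n)}
    (hS : T.Closed S) (hQ : T.IsTile Q) {x y : Fin n} (hf : Follows Q x y)
    (hx : x ∈ S) (hy : y ∈ S) (h : ¬ Follows S y x) : Q ⊆ S := by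
  intro z hz
  by_contra hzS
  obtain ⟨s, t, hst, hs, hk⟩ := hS.exists_gap (Finset.one_lt_card.2 ⟨x, hx, y, hy, hf.2.2.1⟩)
    hQ hz hzS
  have hne := hf.2.2.1
  rcases hst.eq_or_eq hk hf.1 hx with rfl | rfl <;>
    rcases hst.eq_or_eq hk hf.2.1 hy with rfl | rfl
  · exact hne rfl
  · exact hf.2.2.2 z hz hs
  · exact h hst
  · exact hne rfl

theorem Tiling.Closed.subset_of_mem {n : ℕ} {T : Tiling n} {S Q : Finset (Fin n)}
    (hS : T.Closed S) (hQ : T.IsTile Q) {x y : Fin n} (hxy : x ≠ y) (hxQ : x ∈ Q)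
    (hyQ : y ∈ Q) (hx : x ∈ S) (hy : y ∈ S) (h : ¬ Follows S x y) (h' : ¬ Follows S y x) :
    Q ⊆ S := by
  intro z hz
  by_contra hzS
  obtain ⟨s, t, hst, hs, hk⟩ := hS.exists_gap (Finset.one_lt_card.2 ⟨x, hx, y, hy, hxy⟩)
    hQ hz hzS
  rcases hst.eq_or_eq hk hxQ hx with rfl | rfl <;>
    rcases hst.eq_or_eq hk hyQ hy with rfl | rfl
  · exact hxy rfl
  · exact h hst
  · exact h' hst
  · exact hxy rfl

/-- A tile inside `S` never has a side of `S` as its side in the outward direction, so leaving and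
continuing exclude each other; the tile at a directed edge is unique. -/
theorem Tiling.Ends.unique {n : ℕ} {T : Tiling n} {S : Finset (Fin n)} {a b y z : Fin n}
    (h : T.Ends S a b y) (h' : T.Ends S a b z) : y = z := by
  induction h with
  | exit hf =>
    cases h' with
    | exit => rfl
    | step hQ hQS h1 =>
      exact (h1.not_both hQ.1 (hf.restrict hQS h1.2.1 h1.1)).elim
  | step hQ hQS h1 h2 h3 _ ih =>
    cases h' with
    | exit hf => exact (h1.not_both hQ.1 (hf.restrict hQS h1.2.1 h1.1)).elim
    | step hQ' hQS' h1' h2' h3' h' =>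
      obtain rfl := hQ.unique hQ' h1 h1'
      obtain rfl := h2.left_unique h2'
      obtain rfl := h3.left_unique h3'
      exact ih h'

/-- A strand never returns across an edge: each crossed edge cuts off an arc contained in the
previous one. This is what lets the end of a strand restrict its first tiles. -/
theorem Tiling.Ends.eq_or_sbtw {n : ℕ} {T : Tiling n} {S : Finset (Fin n)} {a b y : Fin n}
    (h : T.Ends S a b y) : y = a ∨ sbtw b y a := by
  induction h with
  | exit => exact Or.inl rfl
  | @step a b c d y Q hQ _ h1 h2 h3 _ ih =>
    right
    have s1 := sbtw_of_follows hQ.1 h1 h2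
    have s2 := h3.2.2.2 b h1.2.1
    have s3 := h3.2.2.2 a h1.1
    have s4 := mt (cw_inj (o := b)).1 h3.2.2.1
    rcases ih with rfl | ih
    · exact sbtw_rot s1
    · simp only [sbtw_iff_cw b, cw_self] at *
      omega

theorem Tiling.strand_iff_ends {n : ℕ} {T : Tiling n} {x x' y : Fin n}
    (hx : Follows Finset.univ x x') : T.Strand x y ↔ T.Ends Finset.univ x x' y := by
  constructor
  · rintro ⟨x'', y', hx', hy, hp⟩
    obtain rfl := hx.right_unique hx'
    have key : ∀ e, Relation.ReflTransGen T.Segment e (y, y') → T.Ends Finset.univ e.1 e.2 y := by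
      intro e he
      induction he using Relation.ReflTransGen.head_induction_on with
      | refl => exact .exit hy
      | head h _ ih =>
        obtain ⟨Q, hQ, h1, h2, h3⟩ := h
        exact .step hQ (Finset.subset_univ _) h1 h2 h3 ih
    exact key _ hp
  · intro h
    have key : ∃ y', Follows Finset.univ y' y ∧
        Relation.ReflTransGen T.Segment (x, x') (y, y') := by
      clear hx
      induction h with
      | exit hf => exact ⟨_, hf, .refl⟩
      | step hQ _ h1 h2 h3 _ ih =>
        obtain ⟨y', hy, hp⟩ := ih
        exact ⟨y', hy, .head ⟨_, hQ, h1, h2, h3⟩ hp⟩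
    obtain ⟨y', hy, hp⟩ := key
    exact ⟨x', y', hx, hy, hp⟩

/-! ### Flips preserve the ends of strands -/

/-- The flipped diagonal is not an edge afterwards, so it is not a side of `S`; both triangles on it
must then lie inside `S`. -/
theorem FlipAt.subset {n : ℕ} {T T' : Tiling n} {a b c d : Fin n} (h : FlipAt T T' a b c d)
    {S : Finset (Fin n)} (hS : T.Closed S) (hS' : T'.Closed S) (ha : a ∈ S) (hc : c ∈ S) :
    b ∈ S ∧ d ∈ S := by
  have h1 : ¬ Follows S a c := fun h' => h.not_isEdge_ac (hS' _ _ h')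
  have h2 : ¬ Follows S c a := fun h' => h.not_isEdge_ac (hS' _ _ h').symm
  have hac := (sbtw_distinct h.hb).2.2.symm
  exact ⟨hS.subset_of_mem h.tile hac (by simp) (by simp) ha hc h1 h2 (by simp),
    hS.subset_of_mem h.tile' hac (by simp) (by simp) ha hc h1 h2 (by simp)⟩

theorem triple_subset {n : ℕ} {a b c : Fin n} {S : Finset (Fin n)} (ha : a ∈ S) (hb : b ∈ S)
    (hc : c ∈ S) : ({a, b, c} : Finset (Fin n)) ⊆ S := by
  intro x hx
  simp only [Finset.mem_insert, Finset.mem_singleton] at hx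
  rcases hx with rfl | rfl | rfl <;> assumption

/-- The induction also meets strands that are just crossing `[a, c]`, which has no counterpart in
`T'`. Such a strand is compared with its continuation at the next edge, where it leaves the
quadrilateral. -/
theorem FlipAt.ends {n : ℕ} {T T' : Tiling n} {a b c d : Fin n} (h : FlipAt T T' a b c d)
    {S : Finset (Fin n)} (hS : T.Closed S) (hS' : T'.Closed S) {x y z : Fin n}
    (he : T.Ends S x y z) : (s(x, y) ≠ s(a, c) → T'.Ends S x y z) ∧
      (x = a ∧ y = c → T'.Ends S d c z) ∧ (x = c ∧ y = a → T'.Ends S b a z) := by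
  have hb := h.hb
  have hd : sbtw a c d := sbtw_rot (sbtw_rot h.hd)
  have t := h.symm.tile
  have t' := h.symm.tile'
  have sb := h.symm.hb
  have sd : sbtw b d a := sbtw_rot (sbtw_rot h.symm.hd)
  obtain ⟨n1, n2, n3⟩ := sbtw_distinct hb
  obtain ⟨n4, n5, n6⟩ := sbtw_distinct hd
  induction he with
  | @exit x y hf =>
    have hac : s(x, y) ≠ s(a, c) := by
      intro h'
      have h1 := hS' _ _ hf
      rw [Sym2.eq_iff] at h'
      rcases h' with ⟨rfl, rfl⟩ | ⟨rfl, rfl⟩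
      exacts [h.not_isEdge_ac h1.symm, h.not_isEdge_ac h1]
    refine ⟨fun _ => .exit hf, ?_, ?_⟩
    · rintro ⟨rfl, rfl⟩
      exact (hac rfl).elim
    · rintro ⟨rfl, rfl⟩
      exact (hac Sym2.eq_swap).elim
  | @step x y u w z Q hQ hQS h1 h2 h3 _ ih =>
    obtain ⟨i1, i2, i3⟩ := ih
    by_cases hQ1 : Q = {a, b, c}
    · subst hQ1
      have ha : a ∈ S := hQS (by simp)
      have hc : c ∈ S := hQS (by simp)
      obtain ⟨hbS, hdS⟩ := h.subset hS hS' ha hc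
      have s1 := triple_subset hbS hc hdS
      have s2 := triple_subset hbS hdS ha
      -- Entering through `[a, b]`, one segment becomes two; entering through `[b, c]`, two become
      -- one; entering through `[a, c]` is the intermediate state.
      rcases follows_triple_cases hb h1 with ⟨rfl, rfl⟩ | ⟨rfl, rfl⟩ | ⟨rfl, rfl⟩
      · obtain rfl := h2.left_unique (follows_triple₃ hb)
        obtain rfl := h3.left_unique (follows_triple₂ hb)
        refine ⟨fun _ => ?_, fun h' => (n2 h'.2).elim, fun h' => (n3 h'.1.symm).elim⟩
        refine .step t' s2 (follows_triple₃ sd) (follows_triple₂ sd) (follows_triple sd) ?_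
        refine .step t s1 (follows_triple₃ sb) (follows_triple₂ sb) (follows_triple sb) ?_
        exact i1 (by rw [Ne, Sym2.eq_iff]; tauto)
      · obtain rfl := h2.left_unique (follows_triple hb)
        obtain rfl := h3.left_unique (follows_triple₃ hb)
        refine ⟨fun _ => ?_, fun h' => (n1 h'.1.symm).elim, fun h' => (n3 h'.2).elim⟩
        exact .step t s1 (follows_triple sb) (follows_triple₃ sb) (follows_triple₂ sb)
          (i2 ⟨rfl, rfl⟩)
      · obtain rfl := h2.left_unique (follows_triple₂ hb)
        obtain rfl := h3.left_unique (follows_triple hb)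
        refine ⟨fun h' => (h' Sym2.eq_swap).elim, fun h' => (n3 h'.1).elim, fun _ => ?_⟩
        exact i1 (by rw [Ne, Sym2.eq_iff]; tauto)
    · by_cases hQ2 : Q = {a, c, d}
      · subst hQ2
        have ha : a ∈ S := hQS (by simp)
        have hc : c ∈ S := hQS (by simp)
        obtain ⟨hbS, hdS⟩ := h.subset hS hS' ha hc
        have s1 := triple_subset hbS hc hdS
        have s2 := triple_subset hbS hdS ha
        rcases follows_triple_cases hd h1 with ⟨rfl, rfl⟩ | ⟨rfl, rfl⟩ | ⟨rfl, rfl⟩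
        · obtain rfl := h2.left_unique (follows_triple₃ hd)
          obtain rfl := h3.left_unique (follows_triple₂ hd)
          refine ⟨fun h' => (h' rfl).elim, fun _ => ?_, fun h' => (n3 h'.1.symm).elim⟩
          exact i1 (by rw [Ne, Sym2.eq_iff]; tauto)
        · obtain rfl := h2.left_unique (follows_triple hd)
          obtain rfl := h3.left_unique (follows_triple₃ hd)
          refine ⟨fun _ => ?_, fun h' => (n4 h'.1.symm).elim, fun h' => (n6 h'.2).elim⟩
          refine .step t s1 (follows_triple₂ sb) (follows_triple sb) (follows_triple₃ sb) ?_
          refine .step t' s2 (follows_triple sd) (follows_triple₃ sd) (follows_triple₂ sd) ?_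
          exact i1 (by rw [Ne, Sym2.eq_iff]; tauto)
        · obtain rfl := h2.left_unique (follows_triple₂ hd)
          obtain rfl := h3.left_unique (follows_triple hd)
          refine ⟨fun _ => ?_, fun h' => (n6 h'.1).elim, fun h' => (n5 h'.1.symm).elim⟩
          exact .step t' s2 (follows_triple₂ sd) (follows_triple sd) (follows_triple₃ sd)
            (i3 ⟨rfl, rfl⟩)
      · have key : ∀ {u v}, Follows Q u v → s(u, v) ≠ s(a, c) := by
          intro u v hf h'
          rw [Sym2.eq_iff] at h'
          rcases h' with ⟨rfl, rfl⟩ | ⟨rfl, rfl⟩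
          · exact hQ2 (hQ.unique h.tile' hf (follows_triple hd))
          · exact hQ1 (hQ.unique h.tile hf (follows_triple₃ hb))
        refine ⟨fun _ => ?_, ?_, ?_⟩
        · exact .step (h.isTile hQ hQ1 hQ2) hQS h1 h2 h3
            (i1 (by rw [Sym2.eq_swap]; exact key h3))
        · rintro ⟨rfl, rfl⟩
          exact (key h1 rfl).elim
        · rintro ⟨rfl, rfl⟩
          exact (key h1 Sym2.eq_swap).elim

theorem Flip.ends {n : ℕ} {T T' : Tiling n} (h : Flip T T') {S : Finset (Fin n)}
    (hS : T.Closed S) (hS' : T'.Closed S) {x y z : Fin n} (hf : Follows S x y)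
    (he : T.Ends S x y z) : T'.Ends S x y z := by
  obtain ⟨a, b, c, d, h⟩ := flip_iff.1 h
  refine (h.ends hS hS' he).1 fun h' => ?_
  have h1 := hS' _ _ hf
  rw [Sym2.eq_iff] at h'
  rcases h' with ⟨rfl, rfl⟩ | ⟨rfl, rfl⟩
  exacts [h.not_isEdge_ac h1, h.not_isEdge_ac h1.symm]

theorem FlipEquiv.scott_eq {n : ℕ} (hn : 3 ≤ n) {T T' : Tiling n} (h : FlipEquiv T T') :
    scott hn T = scott hn T' := by
  induction h with
  | rel T T' h =>
    ext1 x
    symm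
    obtain ⟨x', hx⟩ := exists_univ_follows hn x
    rw [scott_apply_eq_iff, Tiling.strand_iff_ends hx]
    refine h.ends T.closed_univ T'.closed_univ hx ?_
    rw [← Tiling.strand_iff_ends hx, ← scott_apply_eq_iff hn]
  | refl => rfl
  | symm _ _ _ ih => exact ih.symm
  | trans _ _ _ _ _ ih ih' => exact ih.trans ih'

/-- No side of `S` crosses a segment between two vertices of `S`, so these flips keep the boundary
of `S`, and with it the ends of strands. -/
theorem FlipAcross.closed_and_ends {n : ℕ} {T T' : Tiling n} {p q : Fin n} {S : Finset (Fin n)}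
    (h : Relation.ReflTransGen (FlipAcross p q) T T') (hp : p ∈ S) (hq : q ∈ S)
    (hS : T.Closed S) :
    T'.Closed S ∧ ∀ x y z, Follows S x y → T.Ends S x y z → T'.Ends S x y z := by
  induction h with
  | refl => exact ⟨hS, fun _ _ _ _ h => h⟩
  | tail _ h ih =>
    have hc : Tiling.Closed _ S := fun x y hf => h.2 x y (ih.1 x y hf)
      (fun h' => hf.2.2.2 q hq (sbtw_quad h'.1 h'.2).1)
      (fun h' => hf.2.2.2 p hp (sbtw_quad h'.2 h'.1).1)
    exact ⟨hc, fun x y z hf he => h.1.ends ih.1 hc hf (ih.2 x y z hf he)⟩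

/-! ### Removing a vertex of a polygon -/

theorem Follows.ne_of_consecutive {n : ℕ} {S : Finset (Fin n)} (hS : 3 ≤ S.card) {p v q : Fin n}
    (hp : Follows S p v) (hq : Follows S v q) : p ≠ q := by
  rintro rfl
  exact hp.not_both hS hq

theorem follows_erase_self {n : ℕ} {S : Finset (Fin n)} (hS : 3 ≤ S.card) {p v q : Fin n}
    (hp : Follows S p v) (hq : Follows S v q) : Follows (S.erase v) p q := by
  refine ⟨Finset.mem_erase.2 ⟨hp.2.2.1, hp.1⟩, Finset.mem_erase.2 ⟨hq.2.2.1.symm, hq.2.1⟩,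
    hp.ne_of_consecutive hS hq, fun k hk hs => ?_⟩
  obtain ⟨hkv, hk⟩ := Finset.mem_erase.1 hk
  have h1 := hp.2.2.2 k hk
  have h2 := hq.2.2.2 k hk
  have h3 := sbtw_of_follows' hS hp hq
  have h4 := mt (cw_inj (o := p)).1 hkv
  simp only [sbtw_iff_cw p, cw_self] at *
  omega

theorem Follows.erase {n : ℕ} {S : Finset (Fin n)} {v x y : Fin n} (h : Follows S x y)
    (hx : x ≠ v) (hy : y ≠ v) : Follows (S.erase v) x y :=
  h.restrict (Finset.erase_subset _ _) (Finset.mem_erase.2 ⟨hx, h.1⟩)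
    (Finset.mem_erase.2 ⟨hy, h.2.1⟩)

theorem follows_erase_cases {n : ℕ} {S : Finset (Fin n)} (hS : 3 ≤ S.card) {p v q x y : Fin n}
    (hp : Follows S p v) (hq : Follows S v q) (h : Follows (S.erase v) x y) :
    (Follows S x y ∧ x ≠ v ∧ y ≠ v) ∨ (x = p ∧ y = q) := by
  obtain ⟨hxv, hx⟩ := Finset.mem_erase.1 h.1
  by_cases hxp : x = p
  · subst hxp
    exact Or.inr ⟨rfl, h.right_unique (follows_erase_self hS hp hq)⟩
  · left
    obtain ⟨z, hz⟩ := exists_follows (by omega) hx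
    have hzv : z ≠ v := by
      rintro rfl
      exact hxp (hz.left_unique hp)
    obtain rfl := h.right_unique (hz.erase hxv hzv)
    exact ⟨hz, hxv, hzv⟩

/-- A vertex at which two consecutive sides of the polygon belong to the same tile belongs to no
other tile in the polygon. -/
theorem Tiling.IsTile.eq_of_mem {n : ℕ} {T : Tiling n} {S Q X : Finset (Fin n)} {p v q : Fin n}
    (hQ : T.IsTile Q) (hp : Follows Q p v) (hq : Follows Q v q) (hpS : Follows S p v)
    (hqS : Follows S v q) (hX : T.IsTile X) (hXS : X ⊆ S) (hv : v ∈ X) : X = Q := by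
  obtain ⟨w, hw⟩ := exists_precedes (by have := hX.1; omega) hv
  by_cases hwp : w = p
  · subst hwp
    exact hX.unique hQ hw hp
  · exfalso
    have hwq : w ≠ q := by
      rintro rfl
      exact hw.not_both hX.1 (hqS.restrict hXS hv hw.1)
    have hwS := hXS hw.1
    exact hQ.one_side (hX.2.1 w v hw).symm hq.2.1 hp.1
      (hqS.sbtw_of_mem hwS hw.2.2.1 hwq)
      (sbtw_rot (sbtw_rot (hpS.sbtw_of_mem hwS hwp hw.2.2.1)))

/-- The strands of two tilings in the polygon with vertex set `S` have the same ends. -/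
def Agree {n : ℕ} (T T' : Tiling n) (S : Finset (Fin n)) : Prop :=
  ∀ x x', Follows S x x' → ∃ y, T.Ends S x x' y ∧ T'.Ends S x x' y

/-! ### Removing a triangular ear -/

/-- A strand that enters the ear from within crosses `[p, q]` near `q` and leaves near `v`; without
the ear it stops at `q`. The second clause is the last stage of such a strand. -/
theorem Tiling.Ends.erase_ear {n : ℕ} {T : Tiling n} {S : Finset (Fin n)} (hS : 3 ≤ S.card)
    {p v q : Fin n} (hp : Follows S p v) (hq : Follows S v q) (hT : T.IsTile {p, v, q})
    {a b y : Fin n} (h : T.Ends S a b y) :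
    (a ≠ v ∧ b ≠ v → T.Ends (S.erase v) a b (if y = v then q else y)) ∧
      (a = v ∧ b = p → y = v) := by
  have hs := sbtw_of_follows' hS hp hq
  have hpq := hp.ne_of_consecutive hS hq
  induction h with
  | exit hf =>
    refine ⟨fun ⟨h1, h2⟩ => ?_, fun h' => h'.1⟩
    rw [if_neg h1]
    exact .exit (hf.erase h2 h1)
  | @step a b c d y Q hQ hQS h1 h2 h3 _ ih =>
    by_cases hv : v ∈ Q
    · obtain rfl := hT.eq_of_mem (follows_triple hs) (follows_triple₂ hs) hp hq hQ hQS hv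
      rcases follows_triple_cases hs h1 with ⟨rfl, rfl⟩ | ⟨rfl, rfl⟩ | ⟨rfl, rfl⟩
      · exact ⟨fun h' => (h'.2 rfl).elim, fun h' => (hp.2.2.1 h'.1).elim⟩
      · exact ⟨fun h' => (h'.1 rfl).elim, fun h' => (hpq h'.2.symm).elim⟩
      · refine ⟨fun _ => ?_, fun h' => (hq.2.2.1 h'.1.symm).elim⟩
        obtain rfl := h2.left_unique (follows_triple₂ hs)
        obtain rfl := h3.left_unique (follows_triple hs)
        rw [if_pos (ih.2 ⟨rfl, rfl⟩)]
        exact .exit (follows_erase_self hS hp hq)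
    · have hne : ∀ {u}, u ∈ Q → u ≠ v := by
        rintro u hu rfl
        exact hv hu
      refine ⟨fun _ => ?_, fun h' => (hne h1.1 h'.1).elim⟩
      exact .step hQ (Finset.subset_erase.2 ⟨hQS, hv⟩) h1 h2 h3
        (ih.1 ⟨hne h3.2.1, hne h3.1⟩)

/-- The strand from `v` passes through the ear and crosses `[p, q]` near `p`, so it becomes the
strand from `p`. -/
theorem Tiling.Ends.erase_ear_start {n : ℕ} {T : Tiling n} {S : Finset (Fin n)}
    (hS : 3 ≤ S.card) {p v q : Fin n} (hp : Follows S p v) (hq : Follows S v q)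
    (hT : T.IsTile {p, v, q}) {y : Fin n} (h : T.Ends S v q y) :
    T.Ends (S.erase v) p q (if y = v then q else y) := by
  have hs := sbtw_of_follows' hS hp hq
  cases h with
  | exit hf => exact (hf.not_both hS hq).elim
  | @step _ _ c d _ Q hQ hQS h1 h2 h3 h =>
    obtain rfl := hT.eq_of_mem (follows_triple hs) (follows_triple₂ hs) hp hq hQ hQS h1.1
    obtain rfl := h2.left_unique (follows_triple hs)
    obtain rfl := h3.left_unique (follows_triple₃ hs)
    exact (h.erase_ear hS hp hq hT).1 ⟨hp.2.2.1, hq.2.2.1.symm⟩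

theorem Agree.erase_ear {n : ℕ} {T T' : Tiling n} {S : Finset (Fin n)} (hS : 3 ≤ S.card)
    {p v q : Fin n} (hp : Follows S p v) (hq : Follows S v q) (hT : T.IsTile {p, v, q})
    (hT' : T'.IsTile {p, v, q}) (h : Agree T T' S) : Agree T T' (S.erase v) := by
  intro x x' hx
  rcases follows_erase_cases hS hp hq hx with ⟨hx, h1⟩ | ⟨rfl, rfl⟩
  · obtain ⟨y, hy, hy'⟩ := h x x' hx
    exact ⟨_, (hy.erase_ear hS hp hq hT).1 h1, (hy'.erase_ear hS hp hq hT').1 h1⟩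
  · obtain ⟨y, hy, hy'⟩ := h v x' hq
    exact ⟨_, hy.erase_ear_start hS hp hq hT, hy'.erase_ear_start hS hp hq hT'⟩

/-! ### Cutting a vertex off a large tile -/

/-- `o`, `p`, `v`, `q` are consecutive vertices of the polygon with vertex set `S` and of the tile
`Q` in this polygon. -/
structure Run {n : ℕ} (T : Tiling n) (S Q : Finset (Fin n)) (o p v q : Fin n) : Prop where
  tile : T.IsTile Q
  subset : Q ⊆ S
  ho : Follows S o p
  hp : Follows S p v
  hq : Follows S v q
  ho' : Follows Q o p
  hp' : Follows Q p v
  hq' : Follows Q v q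
  oq : o ≠ q

theorem Run.card {n : ℕ} {T : Tiling n} {S Q : Finset (Fin n)} {o p v q : Fin n}
    (h : Run T S Q o p v q) : 4 ≤ Q.card := by
  by_contra hc
  have h3 : Q.card = 3 := by have := h.tile.1; omega
  have h1 := eq_triple h3 h.hp' h.ho'
  have h2 := h.hq'.2.1
  rw [h1] at h2
  simp only [Finset.mem_insert, Finset.mem_singleton] at h2
  rcases h2 with h2 | h2 | h2
  exacts [h.hp'.ne_of_consecutive h.tile.1 h.hq' h2.symm, h.hq'.2.2.1 h2.symm, h.oq h2.symm]

theorem Run.card' {n : ℕ} {T : Tiling n} {S Q : Finset (Fin n)} {o p v q : Fin n}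
    (h : Run T S Q o p v q) : 4 ≤ S.card :=
  h.card.trans (Finset.card_le_card h.subset)

theorem Run.card_erase {n : ℕ} {T : Tiling n} {S Q : Finset (Fin n)} {o p v q : Fin n}
    (h : Run T S Q o p v q) : 3 ≤ (Q.erase v).card := by
  rw [Finset.card_erase_of_mem h.hq'.1]
  have := h.card
  omega

theorem Run.sbtw {n : ℕ} {T : Tiling n} {S Q : Finset (Fin n)} {o p v q : Fin n}
    (h : Run T S Q o p v q) : sbtw p v q ∧ sbtw q o p := by
  have h1 := sbtw_of_follows' h.tile.1 h.hp' h.hq'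
  exact ⟨h1, sbtw_rot (sbtw_rot (h.ho'.sbtw_of_mem h.hq'.2.1 h.oq.symm
    (h.hp'.ne_of_consecutive h.tile.1 h.hq').symm))⟩

theorem Run.ne_o {n : ℕ} {T : Tiling n} {S Q : Finset (Fin n)} {o p v q : Fin n}
    (h : Run T S Q o p v q) : o ≠ v :=
  h.ho'.ne_of_consecutive h.tile.1 h.hp'

/-- The diagonal that cuts off the vertex `v`. -/
def Run.cut {n : ℕ} {T : Tiling n} {S Q : Finset (Fin n)} {o p v q : Fin n}
    (h : Run T S Q o p v q) : Tiling n :=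
  T.addDiagonal p q v o h.sbtw.1 h.sbtw.2 fun _ _ hxy hx hy =>
    h.tile.one_side (Or.inl hxy) h.hq'.2.1 h.hp'.1 (sbtw_quad hx hy).1 (sbtw_quad hx hy).2

theorem Run.mem_cut {n : ℕ} {T : Tiling n} {S Q : Finset (Fin n)} {o p v q x y : Fin n}
    (h : Run T S Q o p v q) : s(x, y) ∈ h.cut.diagonals ↔
      s(x, y) = s(p, q) ∨ s(x, y) ∈ T.diagonals :=
  Finset.mem_insert

theorem Run.isEdge_cut {n : ℕ} {T : Tiling n} {S Q : Finset (Fin n)} {o p v q x y : Fin n}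
    (h : Run T S Q o p v q) (hE : T.IsEdge x y) : h.cut.IsEdge x y :=
  hE.imp (fun h' => h.mem_cut.2 (Or.inr h')) id

theorem Run.isEdge_cut_self {n : ℕ} {T : Tiling n} {S Q : Finset (Fin n)} {o p v q : Fin n}
    (h : Run T S Q o p v q) : h.cut.IsEdge p q :=
  Or.inl (h.mem_cut.2 (Or.inl rfl))

theorem Run.eq_of_mem {n : ℕ} {T : Tiling n} {S Q X : Finset (Fin n)} {o p v q : Fin n}
    (h : Run T S Q o p v q) (hX : T.IsTile X) (hXS : X ⊆ S) (hv : v ∈ X) : X = Q :=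
  h.tile.eq_of_mem h.hp' h.hq' h.hp h.hq hX hXS hv

theorem Run.isTile_cut {n : ℕ} {T : Tiling n} {S Q X : Finset (Fin n)} {o p v q : Fin n}
    (h : Run T S Q o p v q) (hX : T.IsTile X) (hXS : X ⊆ S.erase v) : h.cut.IsTile X := by
  have hf := follows_erase_self (by have := h.card'; omega) h.hp h.hq
  refine ⟨hX.1, fun x y hxy => h.isEdge_cut (hX.2.1 x y hxy), fun x hx y hy hD => ?_⟩
  rw [h.mem_cut, Sym2.eq_iff] at hD
  rcases hD with (⟨rfl, rfl⟩ | ⟨rfl, rfl⟩) | hD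
  · exact Or.inl (hf.restrict hXS hx hy)
  · exact Or.inr (hf.restrict hXS hy hx)
  · exact hX.2.2 x hx y hy hD

theorem Run.isTile_cut_self {n : ℕ} {T : Tiling n} {S Q : Finset (Fin n)} {o p v q : Fin n}
    (h : Run T S Q o p v q) : h.cut.IsTile (Q.erase v) := by
  have hf := follows_erase_self h.tile.1 h.hp' h.hq'
  refine ⟨h.card_erase, fun x y hxy => ?_, fun x hx y hy hD => ?_⟩
  · rcases follows_erase_cases h.tile.1 h.hp' h.hq' hxy with ⟨hxy, -⟩ | ⟨rfl, rfl⟩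
    · exact h.isEdge_cut (h.tile.2.1 x y hxy)
    · exact h.isEdge_cut_self
  · rw [h.mem_cut, Sym2.eq_iff] at hD
    rcases hD with (⟨rfl, rfl⟩ | ⟨rfl, rfl⟩) | hD
    · exact Or.inl hf
    · exact Or.inr hf
    · obtain ⟨hx, hx'⟩ := Finset.mem_erase.1 hx
      obtain ⟨hy, hy'⟩ := Finset.mem_erase.1 hy
      exact (h.tile.2.2 x hx' y hy' hD).imp (fun h' => h'.erase hx hy)
        (fun h' => h'.erase hy hx)

theorem Run.isTile_of_cut {n : ℕ} {T : Tiling n} {S Q X : Finset (Fin n)} {o p v q : Fin n}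
    (h : Run T S Q o p v q) (hX : h.cut.IsTile X) (hXS : X ⊆ S.erase v)
    (hne : X ≠ Q.erase v) : T.IsTile X := by
  have hf := follows_erase_self (by have := h.card'; omega) h.hp h.hq
  refine ⟨hX.1, fun x y hxy => ?_, fun x hx y hy hD =>
    hX.2.2 x hx y hy (h.mem_cut.2 (Or.inr hD))⟩
  rcases hX.2.1 x y hxy with hD | hD
  · rw [h.mem_cut, Sym2.eq_iff] at hD
    rcases hD with (⟨rfl, rfl⟩ | ⟨rfl, rfl⟩) | hD
    · exact (hne (hX.unique h.isTile_cut_self hxy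
        (follows_erase_self h.tile.1 h.hp' h.hq'))).elim
    · exact (hxy.not_both hX.1 (hf.restrict hXS hxy.2.1 hxy.1)).elim
    · exact Or.inl hD
  · exact Or.inr hD

theorem Run.closed_cut {n : ℕ} {T : Tiling n} {S Q : Finset (Fin n)} {o p v q : Fin n}
    (h : Run T S Q o p v q) (hS : T.Closed S) : h.cut.Closed (S.erase v) := by
  intro x y hxy
  rcases follows_erase_cases (by have := h.card'; omega) h.hp h.hq hxy with ⟨hxy, -⟩ | ⟨rfl, rfl⟩
  · exact h.isEdge_cut (hS x y hxy)
  · exact h.isEdge_cut_self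

/-- The strand from `v` to `p` disappears, the strand that ended at `v` now ends at `p`, and all
other ends are unchanged. The last two clauses describe strands about to leave through the two sides
at `v`. -/
theorem Run.ends_cut {n : ℕ} {T : Tiling n} {S Q : Finset (Fin n)} {o p v q : Fin n}
    (h : Run T S Q o p v q) {a b y : Fin n} (he : T.Ends S a b y) :
    (a ≠ v ∧ b ≠ v → h.cut.Ends (S.erase v) a b (if y = v then p else y)) ∧
      (a = p ∧ b = v → h.cut.Ends (S.erase v) p q (if y = v then p else y)) ∧
      (a = v ∧ b = p → y = v) ∧ (a = q ∧ b = v → y = q) := by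
  have hQ3 := h.tile.1
  have hS3 : 3 ≤ S.card := by have := h.card'; omega
  have hpv := h.hp.2.2.1
  have hvq := h.hq.2.2.1
  have hov := h.ne_o
  have hfS := follows_erase_self hS3 h.hp h.hq
  have hfQ := follows_erase_self hQ3 h.hp' h.hq'
  have hsub : Q.erase v ⊆ S.erase v := Finset.erase_subset_erase _ h.subset
  induction he with
  | exit hf =>
    refine ⟨fun ⟨h1, h2⟩ => ?_, ?_, fun h' => h'.1, fun h' => h'.1⟩
    · rw [if_neg h1]
      exact .exit (hf.erase h2 h1)
    · rintro ⟨rfl, rfl⟩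
      exact (hf.not_both hS3 h.hp).elim
  | @step a b c d y X hX hXS h1 h2 h3 _ ih =>
    obtain ⟨i1, -, i3, i4⟩ := ih
    by_cases hv : v ∈ X
    · obtain rfl := h.eq_of_mem hX hXS hv
      refine ⟨fun ⟨ha, hb⟩ => ?_, ?_, ?_, ?_⟩
      -- A strand leaving `Q` through `[p, v]` near `v` is diverted through `[o, p]` near `p`; one
      -- leaving through `[v, q]` near `q` now leaves through `[p, q]` near `q`.
      · by_cases hc : c = v
        · subst hc
          obtain rfl := h2.right_unique h.hq'
          obtain rfl := h3.left_unique h.hp'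
          rw [if_pos (i3 ⟨rfl, rfl⟩)]
          exact .step h.isTile_cut_self hsub (h1.erase ha hb) hfQ (h.ho'.erase hov hpv)
            (.exit (h.ho.erase hov hpv))
        · by_cases hd : d = v
          · subst hd
            obtain rfl := h3.right_unique h.hq'
            rw [i4 ⟨rfl, rfl⟩, if_neg hc]
            exact .step h.isTile_cut_self hsub (h1.erase ha hb) (h2.erase hc ha) hfQ
              (.exit hfS)
          · exact .step h.isTile_cut_self hsub (h1.erase ha hb) (h2.erase hc ha)
              (h3.erase hd hc) (i1 ⟨hc, hd⟩)
      · rintro ⟨rfl, rfl⟩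
        obtain rfl := h2.left_unique h.ho'
        have hd : d ≠ b := by
          rintro rfl
          exact h.oq (h3.right_unique h.hq')
        exact .step h.isTile_cut_self hsub hfQ (h2.erase hov hpv) (h3.erase hd hov)
          (i1 ⟨hov, hd⟩)
      · rintro ⟨rfl, rfl⟩
        exact (h1.not_both hQ3 h.hp').elim
      · rintro ⟨rfl, rfl⟩
        exact (h1.not_both hQ3 h.hq').elim
    · have hne : ∀ {u}, u ∈ X → u ≠ v := by
        rintro u hu rfl
        exact hv hu
      have hX' := Finset.subset_erase.2 ⟨hXS, hv⟩
      exact ⟨fun _ => .step (h.isTile_cut hX hX') hX' h1 h2 h3 (i1 ⟨hne h3.2.1, hne h3.1⟩),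
        fun h' => (hne h1.2.1 h'.2).elim, fun h' => (hne h1.1 h'.1).elim,
        fun h' => (hne h1.2.1 h'.2).elim⟩

theorem Agree.cut {n : ℕ} {T T' : Tiling n} {S Q Q' : Finset (Fin n)} {o p v q : Fin n}
    (h : Run T S Q o p v q) (h' : Run T' S Q' o p v q) (hA : Agree T T' S) :
    Agree h.cut h'.cut (S.erase v) := by
  intro x x' hx
  rcases follows_erase_cases (by have := h.card'; omega) h.hp h.hq hx with ⟨hx, h1⟩ | ⟨rfl, rfl⟩
  · obtain ⟨y, hy, hy'⟩ := hA x x' hx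
    exact ⟨_, (h.ends_cut hy).1 h1, (h'.ends_cut hy').1 h1⟩
  · obtain ⟨y, hy, hy'⟩ := hA x v h.hp
    exact ⟨_, (h.ends_cut hy).2.1 ⟨rfl, rfl⟩, (h'.ends_cut hy').2.1 ⟨rfl, rfl⟩⟩

/-- The tile at `v` is recovered from its truncation by restoring `v`; all other tiles in `S` are
unaffected by the cut. -/
theorem Run.isTile_of_isTile {n : ℕ} {T T' : Tiling n} {S Q Q' : Finset (Fin n)}
    {o p v q : Fin n} (h : Run T S Q o p v q) (h' : Run T' S Q' o p v q)
    (H : ∀ X ⊆ S.erase v, 4 ≤ X.card → (h.cut.IsTile X ↔ h'.cut.IsTile X))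
    {X : Finset (Fin n)} (hXS : X ⊆ S) (hc : 4 ≤ X.card) (hX : T.IsTile X) : T'.IsTile X := by
  have hf := follows_erase_self h.tile.1 h.hp' h.hq'
  have hf' := follows_erase_self h'.tile.1 h'.hp' h'.hq'
  have hsub : Q.erase v ⊆ S.erase v := Finset.erase_subset_erase _ h.subset
  have hsub' : Q'.erase v ⊆ S.erase v := Finset.erase_subset_erase _ h'.subset
  by_cases hv : v ∈ X
  · obtain rfl := h.eq_of_mem hX hXS hv
    suffices hQ : X.erase v = Q'.erase v by
      rw [← Finset.insert_erase h.hq'.1, hQ, Finset.insert_erase h'.hq'.1]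
      exact h'.tile
    by_cases h4 : 4 ≤ (X.erase v).card
    · exact ((H _ hsub h4).1 h.isTile_cut_self).unique h'.isTile_cut_self hf hf'
    · by_cases h4' : 4 ≤ (Q'.erase v).card
      · exact h.isTile_cut_self.unique ((H _ hsub' h4').2 h'.isTile_cut_self) hf hf'
      -- Truncations of size three escape the hypothesis, but both are the triangle on `o`, `p`,
      -- `q`.
      · have c1 := h.card_erase
        have c2 := h'.card_erase
        have e1 := h.ho'.erase h.ne_o h.hp.2.2.1
        have e2 := h'.ho'.erase h.ne_o h.hp.2.2.1
        rw [eq_triple (by omega) hf e1, eq_triple (by omega) hf' e2]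
  · have hX' := Finset.subset_erase.2 ⟨hXS, hv⟩
    refine h'.isTile_of_cut ((H X hX' hc).1 (h.isTile_cut hX hX')) hX' ?_
    -- The truncated tile of `T'` has the side `[o, p]`, so as a tile of `T` it would be `Q`, which
    -- contains `v`.
    rintro rfl
    have e2 := h'.ho'.erase h.ne_o h.hp.2.2.1
    rw [hX.unique h.tile e2 (h.ho.restrict h.subset h.ho'.1 h.ho'.2.1)] at hv
    exact hv h.hq'.1

/-! ### Recognising ears and runs by the ends of strands -/

/-- A strand bound for the successor of `v` must keep turning about `v`, crossing one edge at `v`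
after another, and it can do so only through triangles. It sweeps past every tile at `v` that lies
ahead of it. -/
theorem Tiling.Ends.card_eq_three {n : ℕ} {T : Tiling n} {S : Finset (Fin n)} {a v q : Fin n}
    (hq : Follows S v q) (h : T.Ends S a v q) {X : Finset (Fin n)} (hX : T.IsTile X)
    (hXS : X ⊆ S) {w : Fin n} (hw : Follows X w v) (hwa : w = a ∨ sbtw v w a) : X.card = 3 := by
  suffices key : ∀ a b y, T.Ends S a b y → b = v → y = q → w = a ∨ sbtw v w a → X.card = 3 from
    key a v q h rfl rfl hwa
  clear h hwa a
  intro a b y h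
  induction h with
  | exit hf =>
    rintro rfl rfl (rfl | hwa)
    · exact (hw.not_both hX.1 (hf.restrict hXS hw.2.1 hw.1)).elim
    · exact (hf.2.2.2 w (hXS hw.1) hwa).elim
  | @step a b c d y Q hQ hQS h1 h2 h3 hcd ih =>
    rintro rfl rfl hwa
    have hb := sbtw_of_follows hQ.1 h1 h2
    -- If the strand crossed an edge away from `v`, it could end only strictly beyond `d`, and `q`
    -- is not beyond any vertex of `S` other than `v`.
    have hd : d = b := by
      by_contra hd
      have s1 := h3.2.2.2 b h1.2.1
      have s2 := h3.2.2.2 a h1.1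
      have s3 := hq.2.2.2 d (hQS h3.1)
      have s4 := mt (cw_inj (o := b)).1 hd
      have s5 := mt (cw_inj (o := b)).1 h3.2.2.1
      have s6 := hcd.eq_or_sbtw
      rw [← cw_inj (o := b)] at s6
      simp only [sbtw_iff_cw b, cw_self] at *
      omega
    subst hd
    have hQe := eq_triple_of_follows h1 h3 h2
    by_cases hwa' : w = a
    · subst hwa'
      rw [hX.unique hQ hw h1, hQe, card_triple (sbtw_of_follows' hQ.1 h1 h3)]
    -- The edge `[w, v]` cannot cross the far side `[c, a]` of the triangle just passed, so `w` is
    -- still ahead.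
    · refine ih rfl rfl ?_
      have hs := hwa.resolve_left hwa'
      by_contra hne
      rw [not_or] at hne
      have hs' : sbtw d c w := by
        rcases sbtw_or_sbtw h3.2.2.1 (Ne.symm hne.1) hw.2.2.1 with h' | h'
        · exact h'
        · exact (hne.2 (sbtw_rot (sbtw_rot h'))).elim
      exact (hX.2.1 w d hw).symm.not_cross (hQ.2.1 c a h2) hs' (sbtw_rot hs)

/-- To end at the predecessor `p` of `v`, the strand must leave its first tile near `p`, since the
end always lies in the arc cut off; and it must then leave `S` at once, since a further segment
would take it away from `p`. -/
theorem Tiling.Ends.exists_run {n : ℕ} {T : Tiling n} {S : Finset (Fin n)} (hS : 3 ≤ S.card)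
    {o p v q : Fin n} (ho : Follows S o p) (hp : Follows S p v) (hq : Follows S v q)
    (hoq : o ≠ q) (h : T.Ends S v q p) : ∃ Q, Run T S Q o p v q := by
  cases h with
  | exit hf => exact (hf.not_both hS hq).elim
  | @step _ _ c d _ Q hQ hQS h1 h2 h3 h =>
    have hcp : c = p := by
      by_contra hne
      have s1 := sbtw_rot (hp.sbtw_of_mem (hQS h2.1) hne h2.2.2.1)
      have s2 := h.eq_or_sbtw.resolve_left (Ne.symm hne)
      have s3 := h3.2.2.2 v h1.1
      simp only [sbtw_iff_cw v, cw_self] at *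
      omega
    subst hcp
    have hdo : d = o := by
      cases h with
      | exit hf => exact hf.left_unique ho
      | @step _ _ c' d' _ Q' hQ' _ h1' h2' h3' h' =>
        rcases h'.eq_or_sbtw with h' | h'
        · exact (h2'.2.2.1 h'.symm).elim
        · exact (h3'.2.2.2 c h1'.1 h').elim
    subst hdo
    exact ⟨Q, hQ, hQS, ho, hp, hq, h3, h2, h1, hoq⟩

theorem Run.ends {n : ℕ} {T : Tiling n} {S Q : Finset (Fin n)} {o p v q : Fin n}
    (h : Run T S Q o p v q) : T.Ends S v q p :=
  .step h.tile h.subset h.hq' h.hp' h.ho' (.exit h.ho)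

theorem cw_sub {n : ℕ} {o a b : Fin n} (h : cw o a ≤ cw o b) : cw a b = cw o b - cw o a := by
  have := o.2
  have := a.2
  have := b.2
  unfold cw at *
  split_ifs at * <;> omega

/-- In a polygon that is subdivided by a tiling, there is a tile all of whose sides except one are
sides of the polygon. -/
theorem Tiling.Closed.exists_ear_or_run {n : ℕ} {T : Tiling n} {S : Finset (Fin n)}
    (hS : T.Closed S) (hc : 3 ≤ S.card) :
    (∃ p v q, Follows S p v ∧ Follows S v q ∧ T.IsTile {p, v, q}) ∨
      ∃ Q o p v q, Run T S Q o p v q := by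
  classical
  have hne : (Finset.univ.filter fun e : Fin n × Fin n =>
      ∃ Q, T.IsTile Q ∧ Q ⊆ S ∧ Follows Q e.1 e.2).Nonempty := by
    obtain ⟨x, hx⟩ := Finset.card_pos.1 (by omega : 0 < S.card)
    obtain ⟨y, hxy⟩ := exists_follows (by omega) hx
    have hyx : ¬ Follows S y x := fun h' => hxy.not_both hc h'
    obtain ⟨Q, hQ, hf⟩ := T.exists_tile (hS x y hxy) hxy.2.2.1
      (fun h' => hyx (h'.restrict (Finset.subset_univ _) hxy.2.1 hxy.1))
    refine ⟨(x, y), ?_⟩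
    simp only [Finset.mem_filter, Finset.mem_univ, true_and]
    exact ⟨Q, hQ, hS.subset_of_follows hQ hf hxy.1 hxy.2.1 hyx, hf⟩
  -- The directed side with the shortest arc from `b` to `a` is taken. If another side of its tile
  -- were not on the boundary of `S`, the tile beyond it would give a shorter arc.
  obtain ⟨⟨a, b⟩, hab, hmin⟩ := Finset.exists_min_image _ (fun e : Fin n × Fin n => cw e.2 e.1) hne
  simp only [Finset.mem_filter, Finset.mem_univ, true_and] at hab hmin
  obtain ⟨Q, hQ, hQS, hf⟩ := hab
  have key : ∀ {x y}, Follows Q x y → x ≠ a → Follows S x y := by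
    intro x y hxy hxa
    by_contra hxy'
    obtain ⟨Q', hQ', hf'⟩ := T.exists_tile (hQ.2.1 x y hxy).symm hxy.2.2.1.symm
      (fun h' => hxy' (h'.restrict (Finset.subset_univ _) (hQS hxy.1) (hQS hxy.2.1)))
    have h1 := hmin (y, x) ⟨Q', hQ', hS.subset_of_follows hQ' hf' (hQS hxy.2.1) (hQS hxy.1) hxy',
      hf'⟩
    have h2 := hxy.2.2.2 a hf.1
    have h3 := hxy.2.2.2 b hf.2.1
    have h4 := hf.2.2.2 x hxy.1
    have h5 := hf.2.2.2 y hxy.2.1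
    have h6 := mt (cw_inj (o := b)).1 hxa
    have h7 := mt (cw_inj (o := b)).1 hxy.2.2.1
    have h8 := mt (cw_inj (o := b)).1 hf.2.2.1
    have h9 : ¬ (cw b x = cw b b ∧ cw b y = cw b a) := by
      rintro ⟨e1, e2⟩
      rw [cw_inj] at e1 e2
      subst e1 e2
      exact hf.not_both hQ.1 hxy
    simp only [sbtw_iff_cw b, cw_self] at *
    have h10 := cw_sub (o := b) (a := x) (b := y) (by omega)
    omega
  obtain ⟨p, hp⟩ := exists_follows (by have := hQ.1; omega) hf.2.1
  have hpa : p ≠ a := by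
    rintro rfl
    exact hf.not_both hQ.1 hp
  obtain ⟨v, hv⟩ := exists_follows (by have := hQ.1; omega) hp.2.1
  have hbS := key hp hf.2.2.1.symm
  have hpS := key hv hpa
  by_cases hva : v = a
  · subst hva
    exact Or.inl ⟨b, p, v, hbS, hpS, by rw [← eq_triple_of_follows hp hv hf]; exact hQ⟩
  · obtain ⟨q, hq⟩ := exists_follows (by have := hQ.1; omega) hv.2.1
    refine Or.inr ⟨Q, b, p, v, q, hQ, hQS, hbS, hpS, key hq hva, hp, hv, hq, ?_⟩
    rintro rfl
    exact hva (hq.left_unique hf)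

/-! ### The tiles of size at least four are determined by the ends of strands -/

/-- Induction on the number of vertices of `S`, with the tilings generalised, because each step
replaces `T₂` by a flipped tiling or both tilings by their cuts. -/
theorem isTile_iff_of_agree {n : ℕ} {T₁ T₂ : Tiling n} {S : Finset (Fin n)} (h₁ : T₁.Closed S)
    (h₂ : T₂.Closed S) (hS : 3 ≤ S.card) (hA : Agree T₁ T₂ S) {X : Finset (Fin n)} (hX : X ⊆ S)
    (hc : 4 ≤ X.card) : T₁.IsTile X ↔ T₂.IsTile X := by
  induction hm : S.card generalizing T₁ T₂ S X with
  | zero => omega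
  | succ m ih =>
    have hS4 : 4 ≤ S.card := hc.trans (Finset.card_le_card hX)
    have hcard : ∀ {v}, v ∈ S → (S.erase v).card = m := fun hv => by
      rw [Finset.card_erase_of_mem hv]; omega
    rcases h₁.exists_ear_or_run hS with ⟨p, v, q, hp, hq, hT⟩ | ⟨Q, o, p, v, q, h⟩
    · have hs := sbtw_of_follows' hS hp hq
      have hends : T₂.Ends S p v q := by
        obtain ⟨y, hy, hy'⟩ := hA p v hp
        have hq' : T₁.Ends S p v q := .step hT (triple_subset hp.1 hp.2.1 hq.2.1)
          (follows_triple hs) (follows_triple₃ hs) (follows_triple₂ hs) (.exit hq)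
        rwa [hy.unique hq'] at hy'
      have htri : ∀ Q, T₂.IsTile Q → Q ⊆ S → v ∈ Q → Q.card = 3 := by
        intro Q hQ hQS hv
        obtain ⟨w, hw⟩ := exists_precedes (by have := hQ.1; omega) hv
        refine hends.card_eq_three hq hQ hQS hw ?_
        by_cases hwp : w = p
        · exact Or.inl hwp
        · exact Or.inr (sbtw_rot (hp.sbtw_of_mem (hQS hw.1) hwp hw.2.2.1))
      obtain ⟨T, hT₂, hE⟩ := T₂.exists_reach_edge (hp.ne_of_consecutive hS hq) (by
        intro Q hQ hQc x hx y hy hsx hsy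
        -- Otherwise `x`, lying between `p` and `q`, is behind `[p, v]` or `[v, q]`, and `y` is on
        -- the other side of that edge.
        have hv : v ∈ Q := by
          by_contra hv
          have hxv : x ≠ v := by
            rintro rfl
            exact hv hx
          by_cases hxs : sbtw p x v
          · refine hQ.one_side (h₂ p v hp) hx hy hxs ?_
            simp only [sbtw_iff_cw p, cw_self] at *
            omega
          · have hxv' := mt (cw_inj (o := p)).1 hxv
            refine hQ.one_side (h₂ v q hq) hx hy ?_ ?_ <;>
            · simp only [sbtw_iff_cw p, cw_self] at *
              omega
        refine absurd (htri Q hQ ?_ hv) (by omega)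
        -- If the tile left `S`, it would lie behind a side of `S` at `v`, whereas `y` is strictly
        -- on the inner side of both.
        intro z hz
        by_contra hzS
        obtain ⟨s, t, hst, -, hk⟩ := h₂.exists_gap (by omega) hQ hz hzS
        have hky := hk y hy
        rcases hst.eq_or_eq hk hv hp.2.1 with rfl | rfl
        · obtain rfl := hst.right_unique hq
          simp only [sbtw_iff_cw p, cw_self] at *
          omega
        · obtain rfl := hst.left_unique hp
          simp only [sbtw_iff_cw s, cw_self] at *
          omega)
      obtain ⟨hTc, hTe⟩ := FlipAcross.closed_and_ends hT₂ hp.1 hq.2.1 h₂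
      have hT' : T.IsTile {p, v, q} :=
        Tiling.isTile_triple hs (hTc p v hp) (hTc v q hq) hE.symm
      have hA' : Agree T₁ T S := fun x x' hx => by
        obtain ⟨y, hy, hy'⟩ := hA x x' hx
        exact ⟨y, hy, hTe _ _ _ hx hy'⟩
      have hcl : ∀ {T' : Tiling n}, T'.Closed S → T'.IsTile {p, v, q} →
          T'.Closed (S.erase v) := by
        intro T' hT' ht x y hxy
        rcases follows_erase_cases hS hp hq hxy with ⟨hxy, -⟩ | ⟨rfl, rfl⟩
        · exact hT' x y hxy
        · exact (ht.2.1 _ _ (follows_triple₃ hs)).symm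
      rw [FlipAcross.isTile_iff hT₂ hc]
      by_cases hv : v ∈ X
      · have key : ∀ {T' : Tiling n}, T'.IsTile {p, v, q} → ¬ T'.IsTile X := by
          intro T' ht hXt
          rw [ht.eq_of_mem (follows_triple hs) (follows_triple₂ hs) hp hq hXt hX hv,
            card_triple hs] at hc
          omega
        exact iff_of_false (key hT) (key hT')
      · exact ih (hcl h₁ hT) (hcl hTc hT') (by rw [hcard hp.2.1]; omega)
          (hA'.erase_ear hS hp hq hT hT') (Finset.subset_erase.2 ⟨hX, hv⟩) hc (hcard hp.2.1)
    · obtain ⟨Q', h'⟩ : ∃ Q', Run T₂ S Q' o p v q := by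
        obtain ⟨y, hy, hy'⟩ := hA v q h.hq
        rw [hy.unique h.ends] at hy'
        exact hy'.exists_run hS h.ho h.hp h.hq h.oq
      have H : ∀ X ⊆ S.erase v, 4 ≤ X.card → (h.cut.IsTile X ↔ h'.cut.IsTile X) :=
        fun X hX hXc => ih (h.closed_cut h₁) (h'.closed_cut h₂)
          (by rw [hcard h.hp.2.1]; omega) (hA.cut h h') hX hXc (hcard h.hp.2.1)
      exact ⟨h.isTile_of_isTile h' H hX hc,
        h'.isTile_of_isTile h (fun X hX hXc => (H X hX hXc).symm) hX hc⟩

theorem isTile_iff_of_scott_eq {n : ℕ} (hn : 3 ≤ n) {T₁ T₂ : Tiling n}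
    (h : scott hn T₁ = scott hn T₂) {Q : Finset (Fin n)} (hQ : 4 ≤ Q.card) :
    T₁.IsTile Q ↔ T₂.IsTile Q := by
  refine isTile_iff_of_agree T₁.closed_univ T₂.closed_univ (by simpa using hn) ?_
    (Finset.subset_univ Q) hQ
  intro x x' hx
  refine ⟨scott hn T₁ x, ?_, ?_⟩ <;> rw [← Tiling.strand_iff_ends hx, ← scott_apply_eq_iff hn]
  rw [h]

end PolygonTiling

theorem theorem1p1 (n : ℕ) (hn : 3 ≤ n) (T₁ T₂ : PolygonTiling.Tiling n) :
    (PolygonTiling.scott hn T₁ = PolygonTiling.scott hn T₂ ↔ PolygonTiling.FlipEquiv T₁ T₂) ∧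
    (PolygonTiling.FlipEquiv T₁ T₂ ↔
      ∀ Q : Finset (Fin n), 4 ≤ Q.card → (T₁.IsTile Q ↔ T₂.IsTile Q)) :=
  ⟨⟨fun h => PolygonTiling.flipEquiv_of_isTile_iff T₂ T₁
      fun _ hQ => PolygonTiling.isTile_iff_of_scott_eq hn h hQ, fun h => h.scott_eq hn⟩,
    fun h _ hQ => h.isTile_iff hQ, PolygonTiling.flipEquiv_of_isTile_iff T₂ T₁⟩
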